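/- Let $\{C_{i,j}\}_{1\le i<j<\infty}$ be independent and identically distributed random variables whose common distribution $F$ is supported on $[0,\infty)$ and has finite mean $\mathbb{E}[C]$. For every $n$ let $K_n$ be the complete graph on $\{1,\dots,n\}$ in which the undirected link $\{i,j\}$, $i<j$, has capacity $C_{i,j}$. Let $(k_n)$ be a sequence of integers with $2\le k_n\le n$ for all sufficiently large $n$ and $k_n/n\to\alpha\in[0,1]$; the nodes $1,\dots,k_n$ are the session nodes and the other $n-k_n$ nodes act as relays. Let $\mathcal{T}_n(k_n)$ be the set of all Steiner trees for the session, that is, of all subgraphs of $K_n$ that are trees and contain the vertices $1,\dots,k_n$. Let $\pi_n(k_n)$ be the value of the linear program $$\text{maximize }\sum_{T\in\mathcal{T}_n(k_n)}\lambda_T\quad\text{subject to}\quad \sum_{T\in\mathcal{T}_n(k_n):\,T\ni e}\lambda_T\le C_e\ \text{ for every link } e \text{ of } K_n,\qquad \lambda_T\ge 0\ \text{ for every } T\in\mathcal{T}_n(k_n),$$ that is, the maximum rate at which one session node can send the same information to all the other session nodes by routing and duplication, without network coding. Then, almost surely, this maximum is attained for every $n$ with $2\le k_n\le n$, and $$\lim_{n\to\infty}\frac{\pi_n(k_n)}{n}=\Bigl(1-\frac{\alpha}{2}\Bigr)\mathbb{E}[C].$$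 -/

import Mathlib

open Filter Topology MeasureTheory ProbabilityTheory

/-- The finite set of Steiner trees: subgraphs of the complete graph on the `n` nodes `0, …, n - 1`
(not necessarily containing all the nodes) that are trees and contain every session node
`0, …, k - 1`.  The remaining nodes may be used as relays. -/
noncomputable def steinerTrees (n k : ℕ) : Finset (⊤ : SimpleGraph (Fin n)).Subgraph :=
  (Set.toFinite {T : (⊤ : SimpleGraph (Fin n)).Subgraph |
    T.coe.IsTree ∧ ∀ v : Fin n, (v : ℕ) < k → v ∈ T.verts}).toFinset

open Classical in
/-- `w` is a feasible fractional packing of Steiner trees when the undirected link between the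
nodes `i < j` has capacity `c i j`: the weights of the trees are nonnegative, and the total weight
of the trees that use a link is at most the capacity of that link. -/
def IsSteinerPacking (n k : ℕ) (c : ℕ → ℕ → ℝ)
    (w : (⊤ : SimpleGraph (Fin n)).Subgraph → ℝ) : Prop :=
  (∀ T ∈ steinerTrees n k, 0 ≤ w T) ∧
  ∀ i j : Fin n, i < j → ∑ T ∈ steinerTrees n k with T.Adj i j, w T ≤ c i j

/-- The set of values of the objective (the total weight of the Steiner trees) over all the
feasible packings, that is, the set of multicast rates from one session node to all the others
that can be obtained by routing and duplication only, without network coding. -/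
def steinerPackingValues (n k : ℕ) (c : ℕ → ℕ → ℝ) : Set ℝ :=
  {x | ∃ w : (⊤ : SimpleGraph (Fin n)).Subgraph → ℝ,
    IsSteinerPacking n k c w ∧ x = ∑ T ∈ steinerTrees n k, w T}

/-- The value of the Steiner tree packing linear program. -/
noncomputable def steinerPackingValue (n k : ℕ) (c : ℕ → ℕ → ℝ) : ℝ :=
  sSup (steinerPackingValues n k c)

/-!
The rate is bounded from above by a cut argument and from below by an explicit packing.

Upper bound. Root a Steiner tree at a session node and send each of `a` other session nodes to the
first link of its path to the root. This map is injective, so every tree has at least `a` links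
touching these nodes (`le_card_steinerTree_links`), and `a` times the rate is at most the total
capacity of all the links touching them (`steinerPackingValue_mul_le`). There are about
`a * (n - a / 2)` such links. With `a` about `β * n` for a fixed `β < α`, or `a = 1` when `β = 0`,
these links form an increasing sequence of finite sets, so the strong law of large numbers applies
with only a first moment (`ae_tendsto_sum_div_card`) and gives the bound `1 - β / 2` times the mean,
and then `β` tends to `α`.

Lower bound. The value of the program is superadditive and homogeneous in the capacities, and a
capacity dominates `1 / N` times the number of thresholds `1 / N, 2 / N, …, N` that it reaches. So
it is enough to treat unit capacities on a random graph with a fixed link probability `p`, and to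
let `N` tend to infinity (`layerSum`). In the random graph, cut the nodes into a fixed number `B` of
blocks of `L` consecutive nodes. By Hoeffding's inequality and the Borel-Cantelli lemma, almost
surely for all large `n` every node has about `p * L` neighbours in every other block, and
consecutive nodes have at least `p ^ 2 * n / 2` common neighbours. For each block and each `t` up to
about `p * L`, let every session node outside the block hang on its `t`-th neighbour in the block,
and join the consecutive nodes of the block through common neighbours, spreading the weight evenly
over the choices of these. Blocks of relays are used at full rate, blocks containing session nodes
at half rate, because a link between two session nodes is used in both directions. No link then
carries more than `1 + O(1 / B)`, and the total rate is `p * (n - k / 2)` up to a factor tending to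
one as `B` tends to infinity (`block_rate_mem_steinerPackingValues`,
`ae_eventually_exists_le_steinerPackingValues`).

The maximum is attained because the feasible packings form a compact set.
-/

/-! ### The linear program: cut bound and attainment -/

theorem mem_steinerTrees {n k : ℕ} {T : (⊤ : SimpleGraph (Fin n)).Subgraph} :
    T ∈ steinerTrees n k ↔ T.coe.IsTree ∧ ∀ v : Fin n, (v : ℕ) < k → v ∈ T.verts := by
  simp [steinerTrees]

theorem SimpleGraph.Connected.exists_adj_dist_lt {V : Type*} {G : SimpleGraph V}
    (hG : G.Connected) {v r : V} (h : v ≠ r) : ∃ u, G.Adj v u ∧ G.dist u r < G.dist v r := by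
  obtain ⟨p, hp⟩ := hG.exists_walk_length_eq_dist v r
  cases p with
  | nil => exact absurd rfl h
  | cons hadj q =>
    refine ⟨_, hadj, ?_⟩
    have := SimpleGraph.dist_le q
    simp only [SimpleGraph.Walk.length_cons] at hp
    omega

open Classical in
/-- The map sending each of the session nodes `0, …, a - 1` to the first link of its path to the
session node `a` is injective, so a Steiner tree has at least `a` links touching these nodes. -/
theorem le_card_steinerTree_links {n k a : ℕ} (ha : a < k) (hk : k ≤ n)
    {T : (⊤ : SimpleGraph (Fin n)).Subgraph} (hT : T ∈ steinerTrees n k) :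
    a ≤ (Finset.univ.filter fun e : Fin n × Fin n =>
      (e.1 < e.2 ∧ (e.1 : ℕ) < a) ∧ T.Adj e.1 e.2).card := by
  obtain ⟨hT, hs⟩ := mem_steinerTrees.1 hT
  let r : T.verts := ⟨⟨a, by omega⟩, hs _ (by simpa using ha)⟩
  let s : Fin a → T.verts := fun i => ⟨⟨i, by omega⟩, hs _ (by simp; omega)⟩
  have hsr : ∀ i, s i ≠ r := fun i h => by
    have := congrArg (fun v : T.verts => (v.1 : ℕ)) h
    simp only [s, r] at this
    omega
  choose p hadj hdist using fun i => hT.connected.exists_adj_dist_lt (hsr i)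
  have hadj' : ∀ i, T.Adj (s i).1 (p i).1 := fun i => hadj i
  let f : Fin a → Fin n × Fin n := fun i => (min (s i).1 (p i).1, max (s i).1 (p i).1)
  have hinj : Function.Injective f := by
    intro i j hij
    have hval : ∀ i j, s i = s j → i = j := fun i j h => by
      have := congrArg (fun v : T.verts => (v.1 : ℕ)) h
      simpa [s, Fin.ext_iff] using this
    by_contra hne
    have h1 := congrArg Prod.fst hij
    have h2 := congrArg Prod.snd hij
    simp only [f] at h1 h2
    have hsne : (s i).1 ≠ (s j).1 := fun h => hne (hval i j (Subtype.ext h))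
    have : (s i).1 = (p j).1 ∧ (p i).1 = (s j).1 := by
      grind
    have e1 : s i = p j := Subtype.ext this.1
    have e2 : p i = s j := Subtype.ext this.2
    have d1 := hdist i
    have d2 := hdist j
    rw [e2] at d1
    rw [← e1] at d2
    omega
  calc a = (Finset.univ.image f).card := by
        rw [Finset.card_image_of_injective _ hinj]; simp
    _ ≤ _ := by
      refine Finset.card_le_card fun e he => ?_
      obtain ⟨i, -, rfl⟩ := Finset.mem_image.1 he
      have hne : (s i).1 ≠ (p i).1 := (hadj' i).ne
      have hsa : ((s i).1 : ℕ) < a := i.2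
      simp only [Finset.mem_filter, Finset.mem_univ, true_and, f]
      rcases lt_or_gt_of_ne hne with h | h
      · rw [min_eq_left h.le, max_eq_right h.le]
        exact ⟨⟨h, hsa⟩, hadj' i⟩
      · rw [min_eq_right h.le, max_eq_left h.le]
        exact ⟨⟨h, lt_trans (Fin.lt_def.1 h) hsa⟩, (hadj' i).symm⟩

/-- Cut bound: by `le_card_steinerTree_links`, one unit of rate uses at least `a` units of
the capacity of the links that touch the session nodes `0, …, a - 1`. -/
theorem IsSteinerPacking.mul_sum_le {n k a : ℕ} (ha : a < k) (hk : k ≤ n) {c : ℕ → ℕ → ℝ}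
    {w : (⊤ : SimpleGraph (Fin n)).Subgraph → ℝ} (hw : IsSteinerPacking n k c w) :
    a * ∑ T ∈ steinerTrees n k, w T ≤
      ∑ e : Fin n × Fin n with e.1 < e.2 ∧ (e.1 : ℕ) < a, c e.1 e.2 := by
  classical
  calc a * ∑ T ∈ steinerTrees n k, w T
      ≤ ∑ T ∈ steinerTrees n k, ∑ e : Fin n × Fin n with e.1 < e.2 ∧ (e.1 : ℕ) < a,
          if T.Adj e.1 e.2 then w T else 0 := by
        rw [Finset.mul_sum]
        refine Finset.sum_le_sum fun T hT => ?_
        rw [← Finset.sum_filter, Finset.sum_const, nsmul_eq_mul, Finset.filter_filter]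
        refine mul_le_mul_of_nonneg_right ?_ (hw.1 T hT)
        exact_mod_cast le_card_steinerTree_links ha hk hT
    _ = ∑ e : Fin n × Fin n with e.1 < e.2 ∧ (e.1 : ℕ) < a,
          ∑ T ∈ steinerTrees n k with T.Adj e.1 e.2, w T := by
        rw [Finset.sum_comm]
        simp_rw [Finset.sum_filter]
    _ ≤ _ := by
        refine Finset.sum_le_sum fun e he => ?_
        convert hw.2 e.1 e.2 (Finset.mem_filter.1 he).2.1

theorem bddAbove_steinerPackingValues {n k : ℕ} (hk2 : 2 ≤ k) (hk : k ≤ n) (c : ℕ → ℕ → ℝ) :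
    BddAbove (steinerPackingValues n k c) := by
  refine ⟨∑ e : Fin n × Fin n with e.1 < e.2 ∧ (e.1 : ℕ) < 1, c e.1 e.2, ?_⟩
  rintro x ⟨w, hw, rfl⟩
  simpa using hw.mul_sum_le (a := 1) (by omega) hk

/-- The linear program attains its maximum: after setting the weights of the other subgraphs to
zero, the feasible packings form a compact set. -/
theorem isGreatest_steinerPackingValue {n k : ℕ} (hk2 : 2 ≤ k) (hk : k ≤ n) {c : ℕ → ℕ → ℝ}
    (hc : ∀ i j, i < j → 0 ≤ c i j) :
    IsGreatest (steinerPackingValues n k c) (steinerPackingValue n k c) := by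
  classical
  let W : Set ((⊤ : SimpleGraph (Fin n)).Subgraph → ℝ) :=
    {w | IsSteinerPacking n k c w ∧ ∀ T ∉ steinerTrees n k, w T = 0}
  obtain ⟨M, hM⟩ := bddAbove_steinerPackingValues hk2 hk c
  have hcont : Continuous fun w : (⊤ : SimpleGraph (Fin n)).Subgraph → ℝ =>
      ∑ T ∈ steinerTrees n k, w T := by fun_prop
  have himage : steinerPackingValues n k c = (fun w => ∑ T ∈ steinerTrees n k, w T) '' W := by
    ext x
    constructor
    · rintro ⟨w, hw, rfl⟩
      refine ⟨fun T => if T ∈ steinerTrees n k then w T else 0, ⟨⟨?_, ?_⟩, ?_⟩, ?_⟩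
      · intro T hT
        simpa [hT] using hw.1 T hT
      · intro i j hij
        refine le_trans (le_of_eq (Finset.sum_congr (by congr) fun T hT => ?_)) (hw.2 i j hij)
        simp [(Finset.mem_filter.1 hT).1]
      · intro T hT
        simp [hT]
      · exact Finset.sum_congr rfl fun T hT => by simp [hT]
    · rintro ⟨w, hw, rfl⟩
      exact ⟨w, hw.1, rfl⟩
  have hclosed : IsClosed W := by
    have : W = (⋂ T ∈ steinerTrees n k, {w | 0 ≤ w T}) ∩
        (⋂ i : Fin n, ⋂ j : Fin n, ⋂ _ : i < j,
          {w | ∑ T ∈ steinerTrees n k with T.Adj i j, w T ≤ c i j}) ∩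
        ⋂ T, ⋂ _ : T ∉ steinerTrees n k, {w | w T = 0} := by
      ext w
      simp only [W, IsSteinerPacking, Set.mem_inter_iff, Set.mem_iInter, Set.mem_ofPred_eq]
    rw [this]
    refine ((isClosed_biInter fun T _ => isClosed_le (by fun_prop) (by fun_prop)).inter
      (isClosed_iInter fun i => isClosed_iInter fun j => isClosed_iInter fun _ =>
        isClosed_le (by fun_prop) (by fun_prop))).inter
      (isClosed_iInter fun T => isClosed_iInter fun _ => isClosed_eq (by fun_prop) (by fun_prop))
  have hsub : W ⊆ Set.Icc 0 (fun _ => M) := by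
    intro w hw
    have hM0 : ∑ T ∈ steinerTrees n k, w T ≤ M := hM ⟨w, hw.1, rfl⟩
    have hnn : ∀ T ∈ steinerTrees n k, 0 ≤ w T := hw.1.1
    refine ⟨fun T => ?_, fun T => ?_⟩
    · by_cases hT : T ∈ steinerTrees n k
      · exact hnn T hT
      · exact (hw.2 T hT).ge
    · by_cases hT : T ∈ steinerTrees n k
      · exact (Finset.single_le_sum hnn hT).trans hM0
      · rw [hw.2 T hT]
        exact (Finset.sum_nonneg hnn).trans hM0
  have hcompact : IsCompact W := isCompact_Icc.of_isClosed_subset hclosed hsub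
  have hne : (steinerPackingValues n k c).Nonempty :=
    ⟨0, fun _ => 0, ⟨fun _ _ => le_rfl, fun i j hij => by simpa using hc i j hij⟩, by simp⟩
  have := himage ▸ hcompact.image hcont
  exact this.isGreatest_sSup hne

/-! ### Building packings -/

/-- A graph in which one node reaches all the session nodes contains a Steiner tree. -/
theorem exists_steinerTree_of_reachable {n k : ℕ} (H : SimpleGraph (Fin n)) (r : Fin n)
    (hr : ∀ v : Fin n, (v : ℕ) < k → H.Reachable r v) :
    ∃ T ∈ steinerTrees n k, ∀ u v, T.Adj u v → H.Adj u v := by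
  let C := H.connectedComponentMk r
  obtain ⟨F, hF, hFT⟩ := C.connected_toSimpleGraph.exists_isTree_le
  let T : (⊤ : SimpleGraph (Fin n)).Subgraph :=
    { verts := C.supp
      Adj := fun u v => ∃ (hu : u ∈ C.supp) (hv : v ∈ C.supp), F.Adj ⟨u, hu⟩ ⟨v, hv⟩
      adj_sub := by
        rintro u v ⟨hu, hv, h⟩
        have := h.ne
        simpa using this
      edge_vert := by
        rintro u v ⟨hu, hv, h⟩
        exact hu
      symm := ⟨by
        rintro u v ⟨hu, hv, h⟩
        exact ⟨hv, hu, h.symm⟩⟩ }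
  have hT : T.coe = F := by
    ext u v
    simp only [T, SimpleGraph.Subgraph.coe_adj]
    exact ⟨fun ⟨_, _, h⟩ => h, fun h => ⟨u.2, v.2, h⟩⟩
  refine ⟨T, mem_steinerTrees.2 ⟨?_, ?_⟩, ?_⟩
  · rw [hT]; exact hFT
  · intro v hv
    exact (SimpleGraph.ConnectedComponent.eq.2 (hr v hv)).symm
  · rintro u v ⟨hu, hv, h⟩
    exact hF h

open Classical in
/-- A weighted family of graphs, each joining up all the session nodes, can be pruned to a packing
of Steiner trees with the same total weight. -/
theorem sum_mem_steinerPackingValues {n k : ℕ} {c : ℕ → ℕ → ℝ} {ι : Type*} (s : Finset ι)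
    (H : ι → SimpleGraph (Fin n)) (r : ι → Fin n) (x : ι → ℝ)
    (hr : ∀ i ∈ s, ∀ v : Fin n, (v : ℕ) < k → (H i).Reachable (r i) v)
    (hx : ∀ i ∈ s, 0 ≤ x i)
    (hc : ∀ u v : Fin n, u < v → ∑ i ∈ s with (H i).Adj u v, x i ≤ c u v) :
    ∑ i ∈ s, x i ∈ steinerPackingValues n k c := by
  choose! T hT hTH using fun i (hi : i ∈ s) => exists_steinerTree_of_reachable (H i) (r i) (hr i hi)
  refine ⟨fun S => ∑ i ∈ s with T i = S, x i, ⟨?_, ?_⟩, ?_⟩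
  · intro S _
    exact Finset.sum_nonneg fun i hi => hx i (Finset.mem_filter.1 hi).1
  · intro u v huv
    refine le_trans ?_ (hc u v huv)
    simp_rw [Finset.sum_filter (fun i => T i = _)]
    rw [Finset.sum_comm, Finset.sum_filter]
    refine Finset.sum_le_sum fun i hi => ?_
    rw [Finset.sum_ite_eq]
    by_cases hadj : (T i).Adj u v
    · rw [if_pos (hTH i hi u v hadj)]
      split_ifs
      · exact le_rfl
      · exact hx i hi
    · rw [if_neg (by simp [hadj])]
      split_ifs
      · exact hx i hi
      · exact le_rfl
  · exact (Finset.sum_fiberwise_of_maps_to hT x).symm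

/-- The value of the linear program is superadditive, homogeneous and monotone in the
capacities. -/
theorem sum_mul_mem_steinerPackingValues {n k : ℕ} {c : ℕ → ℕ → ℝ} {ι : Type*} (s : Finset ι)
    {c' : ι → ℕ → ℕ → ℝ} {x : ι → ℝ} {a : ℝ} (ha : 0 ≤ a)
    (hx : ∀ m ∈ s, x m ∈ steinerPackingValues n k (c' m))
    (hc : ∀ i j, i < j → a * ∑ m ∈ s, c' m i j ≤ c i j) :
    a * ∑ m ∈ s, x m ∈ steinerPackingValues n k c := by
  choose! w hw hxw using hx
  refine ⟨fun T => a * ∑ m ∈ s, w m T, ⟨?_, ?_⟩, ?_⟩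
  · intro T hT
    exact mul_nonneg ha (Finset.sum_nonneg fun m hm => (hw m hm).1 T hT)
  · intro i j hij
    refine le_trans ?_ (hc i j hij)
    rw [← Finset.mul_sum, Finset.sum_comm]
    exact mul_le_mul_of_nonneg_left (Finset.sum_le_sum fun m hm => (hw m hm).2 i j hij) ha
  · rw [← Finset.mul_sum, Finset.sum_comm, Finset.sum_congr rfl hxw]

/-! ### The packing with core blocks -/

theorem Finset.exists_injOn_of_le_card {α : Type*} [Nonempty α] {s : Finset α} {m : ℕ}
    (h : m ≤ s.card) : ∃ f : ℕ → α, (∀ i < m, f i ∈ s) ∧ ∀ i < m, ∀ j < m, f i = f j → i = j := by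
  classical
  refine ⟨fun i => if hi : i < m then (s.equivFin.symm ⟨i, hi.trans_le h⟩ : α)
    else Classical.arbitrary α, fun i hi => ?_, fun i hi j hj hij => ?_⟩
  · simp [hi]
  · simp only [hi, hj, dite_true] at hij
    simpa using s.equivFin.symm.injective (Subtype.ext hij)

theorem Finset.sum_le_of_subsingleton_support {ι : Type*} {s : Finset ι} {f : ι → ℝ} {M : ℝ}
    (hM : 0 ≤ M) (hf : ∀ i ∈ s, f i ≤ M)
    (h : ∀ i ∈ s, ∀ j ∈ s, f i ≠ 0 → f j ≠ 0 → i = j) : ∑ i ∈ s, f i ≤ M := by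
  by_cases hz : ∃ i ∈ s, f i ≠ 0
  · obtain ⟨i, hi, hne⟩ := hz
    rw [Finset.sum_eq_single_of_mem i hi fun j hj hji => by
      by_contra h0
      exact hji (h j hj i hi h0 hne)]
    exact hf i hi
  · push Not at hz
    rw [Finset.sum_eq_zero hz]
    exact hM

/-- The rate (up to a common factor) of the trees whose core is the block
`b * L, …, b * L + L - 1`. A block containing session nodes gets half of the rate of a block of
relays: a link between session nodes of two blocks is used by the trees of both blocks. -/
noncomputable def blockRate (k L b : ℕ) : ℝ := if b * L < k then 1 / 2 else 1

/-- A link of the connected graph with core block `b` and indices `t`, `q`, directed towards the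
node selected by `att` or `com`: a session node `u` outside the block is attached to its `t`-th
neighbour `att b u t` in the block, and consecutive nodes `i`, `i + 1` of the block are joined
through their `q`-th common neighbour `com i q`. -/
def BlockLink {n : ℕ} (k L : ℕ) (att : ℕ → Fin n → ℕ → Fin n) (com : ℕ → ℕ → Fin n)
    (b t q : ℕ) (u v : Fin n) : Prop :=
  ((u : ℕ) / L ≠ b ∧ (u : ℕ) < k ∧ v = att b u t) ∨
  ((u : ℕ) / L = b ∧ ((u : ℕ) + 1 < n ∧ ((u : ℕ) + 1) / L = b ∧ v = com u q)) ∨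
  ((u : ℕ) / L = b ∧ (1 ≤ (u : ℕ) ∧ ((u : ℕ) - 1) / L = b ∧ v = com (u - 1) q))

theorem blockRate_nonneg (k L b : ℕ) : 0 ≤ blockRate k L b := by
  unfold blockRate; split_ifs <;> norm_num

theorem blockRate_le_one (k L b : ℕ) : blockRate k L b ≤ 1 := by
  unfold blockRate; split_ifs <;> norm_num

theorem blockRate_div_of_lt {k L u : ℕ} (h : u < k) : blockRate k L (u / L) = 1 / 2 := by
  unfold blockRate
  rw [if_pos ((Nat.div_mul_le_self u L).trans_lt h)]

section

variable {n k B L T Q : ℕ} {G : SimpleGraph (Fin n)}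
  {att : ℕ → Fin n → ℕ → Fin n} {com : ℕ → ℕ → Fin n}

/-- Each node `v` of the core block with number `v / L` is selected at most once by `u`, so the
attaching links `u, v` carry at most the rate of that block. -/
theorem attach_load_le (hQ : 0 < Q)
    (hatt : ∀ b < B, ∀ u : Fin n, (u : ℕ) / L ≠ b → ∀ t < T,
      (att b u t : ℕ) / L = b)
    (hatt_inj : ∀ b < B, ∀ u : Fin n, (u : ℕ) / L ≠ b → ∀ t < T, ∀ t' < T,
      att b u t = att b u t' → t = t') (u v : Fin n) :
    ∑ b ∈ Finset.range B, ∑ t ∈ Finset.range T, ∑ _q ∈ Finset.range Q,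
      (if (u : ℕ) / L ≠ b ∧ (u : ℕ) < k ∧ v = att b u t then blockRate k L b / Q else 0) ≤
    if (u : ℕ) < k then blockRate k L ((v : ℕ) / L) else 0 := by
  have hQ' : (Q : ℝ) ≠ 0 := by positivity
  rw [← Finset.sum_product']
  apply Finset.sum_le_of_subsingleton_support
  · split_ifs
    · exact blockRate_nonneg _ _ _
    · exact le_rfl
  · rintro ⟨b, t⟩ hbt
    simp only [Finset.mem_product, Finset.mem_range] at hbt
    simp only [Finset.sum_const, Finset.card_range, nsmul_eq_mul]
    split_ifs with h1 h2 h2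
    · rw [h1.2.2, hatt b hbt.1 u h1.1 t hbt.2]
      apply le_of_eq; field_simp
    · exact absurd h1.2.1 h2
    · simpa using blockRate_nonneg _ _ _
    · simp
  · rintro ⟨b, t⟩ hbt ⟨b', t'⟩ hbt' h h'
    simp only [Finset.mem_product, Finset.mem_range] at hbt hbt'
    have h1 : (u : ℕ) / L ≠ b ∧ (u : ℕ) < k ∧ v = att b u t := by
      by_contra hc; simp [hc] at h
    have h1' : (u : ℕ) / L ≠ b' ∧ (u : ℕ) < k ∧ v = att b' u t' := by
      by_contra hc; simp [hc] at h'
    have e1 := hatt b hbt.1 u h1.1 t hbt.2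
    have e2 := hatt b' hbt'.1 u h1'.1 t' hbt'.2
    rw [← h1.2.2] at e1
    rw [← h1'.2.2] at e2
    have hb : b = b' := e1.symm.trans e2
    subst hb
    have := hatt_inj b hbt.1 u h1.1 t hbt.2 t' hbt'.2 (h1.2.2.symm.trans h1'.2.2)
    rw [this]

/-- Here `R b t q` says that the links directed from `u` to a common neighbour `f q` of two
consecutive nodes belong to the tree `b, t, q`. Such a link towards `v` determines the block `b` of
`u` and the index `q`, so it carries at most the share `1 / Q` for each of the `T` values of `t`. -/
theorem connect_load_le {P : Prop} {f : ℕ → Fin n}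
    (hf : P → ∀ q < Q, ∀ q' < Q, f q = f q' → q = q') (u v : Fin n)
    {R : ℕ → ℕ → ℕ → Prop} [∀ b t q, Decidable (R b t q)]
    (hR : ∀ b t q, R b t q → (u : ℕ) / L = b ∧ P ∧ v = f q) :
    ∑ b ∈ Finset.range B, ∑ t ∈ Finset.range T, ∑ q ∈ Finset.range Q,
      (if R b t q then blockRate k L b / Q else 0) ≤ (T : ℝ) / Q := by
  rw [Finset.sum_comm]
  calc _ ≤ ∑ t ∈ Finset.range T, (1 : ℝ) / Q := ?_
    _ = (T : ℝ) / Q := by simp [div_eq_mul_inv]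
  refine Finset.sum_le_sum fun t _ => ?_
  rw [← Finset.sum_product']
  apply Finset.sum_le_of_subsingleton_support
  · positivity
  · rintro ⟨b, q⟩ -
    dsimp only
    split_ifs
    · have := blockRate_le_one k L b
      gcongr
    · positivity
  · rintro ⟨b, q⟩ hbq ⟨b', q'⟩ hbq' h h'
    simp only [Finset.mem_product, Finset.mem_range] at hbq hbq'
    have h1 : R b t q := by
      by_contra hc; simp [hc] at h
    have h1' : R b' t q' := by
      by_contra hc; simp [hc] at h'
    obtain ⟨rfl, hP, hv⟩ := hR _ _ _ h1
    obtain ⟨rfl, -, hv'⟩ := hR _ _ _ h1'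
    rw [hf hP q hbq.2 q' hbq'.2 (hv.symm.trans hv')]

open Classical in
/-- The load that the trees put on the link `u, v` in the direction from `u` to `v`: attaching
links, and joins of `u` to its successor and to its predecessor. -/
theorem blockLink_load_le (hQ : 0 < Q)
    (hatt : ∀ b < B, ∀ u : Fin n, (u : ℕ) / L ≠ b → ∀ t < T,
      (att b u t : ℕ) / L = b)
    (hatt_inj : ∀ b < B, ∀ u : Fin n, (u : ℕ) / L ≠ b → ∀ t < T, ∀ t' < T,
      att b u t = att b u t' → t = t')
    (hcom_inj : ∀ i, i + 1 < n → ∀ q < Q, ∀ q' < Q, com i q = com i q' → q = q')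
    (u v : Fin n) :
    ∑ b ∈ Finset.range B, ∑ t ∈ Finset.range T, ∑ q ∈ Finset.range Q,
      (if BlockLink k L att com b t q u v then blockRate k L b / Q else 0) ≤
    (if (u : ℕ) < k then blockRate k L ((v : ℕ) / L) else 0) + 2 * (T / Q) := by
  have h1 := attach_load_le (k := k) hQ hatt hatt_inj u v
  have h2 := connect_load_le (k := k) (L := L) (B := B) (T := T) (P := (u : ℕ) + 1 < n)
    (f := com u) (fun h => hcom_inj u h) u v
    (R := fun b t q =>
      (u : ℕ) / L = b ∧ ((u : ℕ) + 1 < n ∧ ((u : ℕ) + 1) / L = b ∧ v = com u q))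
    (fun b t q h => ⟨h.1, h.2.1, h.2.2.2⟩)
  have h3 := connect_load_le (k := k) (L := L) (B := B) (T := T) (P := 1 ≤ (u : ℕ))
    (f := com (u - 1)) (fun h => hcom_inj (u - 1) (by omega)) u v
    (R := fun b t q =>
      (u : ℕ) / L = b ∧ (1 ≤ (u : ℕ) ∧ ((u : ℕ) - 1) / L = b ∧ v = com (u - 1) q))
    (fun b t q h => ⟨h.1, h.2.1, h.2.2.2⟩)
  have h4 := add_le_add (add_le_add h1 h2) h3
  simp only [← Finset.sum_add_distrib] at h4
  refine (Finset.sum_le_sum fun b _ => Finset.sum_le_sum fun t _ =>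
    Finset.sum_le_sum fun q _ => ?_).trans (h4.trans (by linarith))
  have hr : 0 ≤ blockRate k L b / Q := div_nonneg (blockRate_nonneg _ _ _) (by positivity)
  unfold BlockLink
  split_ifs <;> first | linarith | (exfalso; tauto)

/-- Successive nodes of the core block are joined through common neighbours, so the first node of
the block reaches all of them. -/
theorem reachable_block_start (hL : 0 < L) {b t q : ℕ} (hb : (b + 1) * L ≤ n)
    (hcom : ∀ i, (h : i + 1 < n) → G.Adj ⟨i, by omega⟩ (com i q) ∧ G.Adj ⟨i + 1, h⟩ (com i q))
    (v : Fin n) (hv : (v : ℕ) / L = b) :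
    (SimpleGraph.fromRel (BlockLink k L att com b t q)).Reachable
      ⟨b * L, by nlinarith⟩ v := by
  have key : ∀ j, j < L → ∀ h : b * L + j < n,
      (SimpleGraph.fromRel (BlockLink k L att com b t q)).Reachable
      ⟨b * L, by omega⟩ ⟨b * L + j, h⟩ := by
    intro j
    induction j with
    | zero => intro _ _; exact SimpleGraph.Reachable.refl _
    | succ j ih =>
      intro hj h
      have h0 : b * L + j + 1 < n := h
      have hdiv : ∀ i, i < L → (b * L + i) / L = b := fun i hi => by
        rw [mul_comm, Nat.mul_add_div hL, Nat.div_eq_of_lt hi, add_zero]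
      obtain ⟨a1, a2⟩ := hcom (b * L + j) h0
      have hd1 := hdiv j (by omega)
      have hd2 : (b * L + j + 1) / L = b := hdiv (j + 1) hj
      have e1 : (SimpleGraph.fromRel (BlockLink k L att com b t q)).Adj
          ⟨b * L + j, by omega⟩ (com (b * L + j) q) :=
        (SimpleGraph.fromRel_adj _ _ _).2
          ⟨a1.ne, Or.inl (Or.inr (Or.inl ⟨hd1, h0, hd2, rfl⟩))⟩
      have e2 : (SimpleGraph.fromRel (BlockLink k L att com b t q)).Adj
          ⟨b * L + j + 1, h0⟩ (com (b * L + j) q) :=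
        (SimpleGraph.fromRel_adj _ _ _).2
          ⟨a2.ne, Or.inl (Or.inr (Or.inr ⟨hd2, by simp, by simpa using hd1, by simp⟩))⟩
      exact ((ih (by omega) (by omega)).trans e1.reachable).trans e2.symm.reachable
  have hv' : (v : ℕ) = b * L + v % L := by
    have := Nat.div_add_mod (v : ℕ) L
    rw [hv] at this
    linarith [mul_comm L b]
  have := key (v % L) (Nat.mod_lt _ hL) (by omega)
  convert this using 1
  exact Fin.ext hv'

end

open Classical in
/-- The packing behind the lower bound. Cut the nodes into blocks of `L` consecutive nodes, let
every node have at least `T` neighbours in every other block, and let consecutive nodes have at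
least `Q` common neighbours. The trees with a given core block use every attaching link equally
and spread the links joining the core over `Q` choices, which makes the extra load at most
`4 * T / Q`. -/
theorem block_rate_mem_steinerPackingValues {n k B L T Q : ℕ} (G : SimpleGraph (Fin n))
    (hL : 0 < L) (hBL : B * L ≤ n) (hQ : 0 < Q) {c : ℕ → ℕ → ℝ}
    (hc : ∀ u v : Fin n, u < v → (if G.Adj u v then 1 else 0) ≤ c u v)
    (hatt : ∀ b < B, ∀ u : Fin n, (u : ℕ) / L ≠ b →
      T ≤ (Finset.univ.filter fun v : Fin n => (v : ℕ) / L = b ∧ G.Adj u v).card)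
    (hcom : ∀ i, (h : i + 1 < n) →
      Q ≤ (Finset.univ.filter fun w : Fin n =>
        G.Adj ⟨i, by omega⟩ w ∧ G.Adj ⟨i + 1, h⟩ w).card) :
    T * (∑ b ∈ Finset.range B, blockRate k L b) / (1 + 4 * (T / Q)) ∈
      steinerPackingValues n k c := by
  rcases Nat.eq_zero_or_pos n with rfl | hn
  · have hB : B = 0 := by
      rcases Nat.eq_zero_or_pos B with h | h
      · exact h
      · have := Nat.mul_pos h hL
        omega
    subst hB
    exact ⟨fun _ => 0, ⟨fun _ _ => le_rfl, fun u => u.elim0⟩, by simp⟩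
  have : Nonempty (Fin n) := ⟨⟨0, hn⟩⟩
  choose! att hatt_mem hatt_inj using fun b (hb : b < B) (u : Fin n) (hu : (u : ℕ) / L ≠ b) =>
    Finset.exists_injOn_of_le_card (hatt b hb u hu)
  have hcom' : ∀ i, ∃ f : ℕ → Fin n, (∀ h : i + 1 < n,
      (∀ q < Q, G.Adj ⟨i, by omega⟩ (f q) ∧ G.Adj ⟨i + 1, h⟩ (f q)) ∧
      ∀ q < Q, ∀ q' < Q, f q = f q' → q = q') := by
    intro i
    by_cases h : i + 1 < n
    · obtain ⟨f, hf, hf'⟩ := Finset.exists_injOn_of_le_card (hcom i h)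
      exact ⟨f, fun _ => ⟨fun q hq => by simpa using hf q hq, hf'⟩⟩
    · exact ⟨fun _ => ⟨0, hn⟩, fun h' => absurd h' h⟩
  choose com hcom using hcom'
  have hatt_div : ∀ b < B, ∀ u : Fin n, (u : ℕ) / L ≠ b → ∀ t < T, (att b u t : ℕ) / L = b :=
    fun b hb u hu t ht => (Finset.mem_filter.1 (hatt_mem b hb u hu t ht)).2.1
  have hatt_adj : ∀ b < B, ∀ u : Fin n, (u : ℕ) / L ≠ b → ∀ t < T, G.Adj u (att b u t) :=
    fun b hb u hu t ht => (Finset.mem_filter.1 (hatt_mem b hb u hu t ht)).2.2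
  set D : ℝ := 1 + 4 * (T / Q) with hD
  have hDpos : 0 < D := by positivity
  let s := Finset.range B ×ˢ (Finset.range T ×ˢ Finset.range Q)
  obtain ⟨H, hH⟩ : ∃ H : ℕ × ℕ × ℕ → SimpleGraph (Fin n), ∀ i,
      H i = SimpleGraph.fromRel (BlockLink k L att com i.1 i.2.1 i.2.2) := ⟨_, fun _ => rfl⟩
  have hlt : ∀ b < B, (b + 1) * L ≤ n := fun b hb => (Nat.mul_le_mul_right L hb).trans hBL
  have hsum : ∑ i ∈ s, blockRate k L i.1 / Q / D =
      T * (∑ b ∈ Finset.range B, blockRate k L b) / D := by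
    have hQ' : (Q : ℝ) ≠ 0 := by positivity
    simp only [s, Finset.sum_product, Finset.sum_const, Finset.card_product, Finset.card_range,
      nsmul_eq_mul]
    push_cast
    rw [Finset.mul_sum, Finset.sum_div]
    refine Finset.sum_congr rfl fun b _ => ?_
    field_simp
  rw [← hsum]
  refine sum_mem_steinerPackingValues s H
    (fun i => if h : i.1 < B then ⟨i.1 * L, by nlinarith [hlt i.1 h]⟩ else ⟨0, hn⟩) _ ?_ ?_ ?_
  · rintro ⟨b, t, q⟩ hi v hv
    simp only [s, Finset.mem_product, Finset.mem_range] at hi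
    obtain ⟨hb, ht, hq⟩ := hi
    simp only [hb, dite_true, hH]
    have hblock := reachable_block_start (k := k) (att := att) (com := com) (t := t) (q := q) hL
      (hlt b hb) (G := G) (fun i h => (hcom i h).1 q hq)
    by_cases hvb : (v : ℕ) / L = b
    · exact hblock v hvb
    · have hadj : (SimpleGraph.fromRel (BlockLink k L att com b t q)).Adj v (att b v t) :=
        (SimpleGraph.fromRel_adj _ _ _).2
          ⟨(hatt_adj b hb v hvb t ht).ne, Or.inl (Or.inl ⟨hvb, hv, rfl⟩)⟩
      exact (hblock _ (hatt_div b hb v hvb t ht)).trans hadj.symm.reachable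
  · rintro ⟨b, t, q⟩ _
    have := blockRate_nonneg k L b
    positivity
  · intro u v huv
    refine le_trans ?_ (hc u v huv)
    have hle : ∀ b < B, ∀ t < T, ∀ q < Q, ∀ x y : Fin n, BlockLink k L att com b t q x y →
        G.Adj x y := by
      rintro b hb t ht q hq x y (⟨h1, -, rfl⟩ | ⟨-, h2, -, rfl⟩ | ⟨-, h2, -, rfl⟩)
      · exact hatt_adj b hb x h1 t ht
      · exact ((hcom x h2).1 q hq).1
      · have h3 : (x : ℕ) - 1 + 1 < n := by omega
        have := ((hcom (x - 1) h3).1 q hq).2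
        convert this using 1
        exact Fin.ext (by simp; omega)
    by_cases hG : G.Adj u v
    · rw [if_pos hG]
      have l1 := blockLink_load_le (k := k) hQ hatt_div hatt_inj
        (fun i h => (hcom i h).2) u v
      have l2 := blockLink_load_le (k := k) hQ hatt_div hatt_inj
        (fun i h => (hcom i h).2) v u
      have htot : ∑ i ∈ s with (H i).Adj u v, blockRate k L i.1 / Q ≤ D := by
        rw [Finset.sum_filter]
        simp only [s, Finset.sum_product]
        have l3 := add_le_add l1 l2
        simp only [← Finset.sum_add_distrib] at l3
        refine (Finset.sum_le_sum fun b _ => Finset.sum_le_sum fun t _ =>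
          Finset.sum_le_sum fun q _ => ?_).trans (l3.trans ?_)
        · have hr : 0 ≤ blockRate k L b / Q := div_nonneg (blockRate_nonneg _ _ _) (by positivity)
          simp only [hH, SimpleGraph.fromRel_adj]
          split_ifs <;> first | linarith | (exfalso; tauto)
        -- Both directions attach only if `u` and `v` are both session nodes, and then both of their
        -- blocks run at half rate.
        · have hux := blockRate_le_one k L (u / L)
          have hvx := blockRate_le_one k L (v / L)
          rw [hD]
          split_ifs with h1 h2 h2
          · rw [blockRate_div_of_lt h1, blockRate_div_of_lt h2]; linarith
          · linarith
          · linarith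
          · linarith
      rw [← Finset.sum_div]
      exact (div_le_one hDpos).2 htot
    · rw [if_neg hG]
      refine le_of_eq (Finset.sum_eq_zero ?_)
      rintro ⟨b, t, q⟩ hi
      exfalso
      obtain ⟨hi, hadj⟩ := Finset.mem_filter.1 hi
      rw [hH] at hadj
      simp only [s, Finset.mem_product, Finset.mem_range] at hi
      obtain ⟨hb, ht, hq⟩ := hi
      rcases ((SimpleGraph.fromRel_adj _ _ _).1 hadj).2 with h | h
      · exact hG (hle b hb t ht q hq u v h)
      · exact hG (hle b hb t ht q hq v u h).symm

/-! ### Probabilistic tools -/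

/-- An increasing sequence of finite sets whose sizes tend to infinity consists of initial segments
of some enumeration without repetition. -/
theorem Finset.exists_enumeration_of_monotone {ι : Type*} [DecidableEq ι] {A : ℕ → Finset ι}
    (hA : Monotone A) (hcard : Tendsto (fun n => (A n).card) atTop atTop) :
    ∃ e : ℕ → ι, Function.Injective e ∧ ∀ n, A n = (Finset.range (A n).card).image e := by
  let l : ℕ → List ι := fun n =>
    Nat.rec (A 0).toList (fun n l => l ++ (A (n + 1) \ A n).toList) n
  have hsucc : ∀ n, l (n + 1) = l n ++ (A (n + 1) \ A n).toList := fun n => rfl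
  have hmem : ∀ n x, x ∈ l n ↔ x ∈ A n := by
    intro n
    induction n with
    | zero => intro x; exact Finset.mem_toList
    | succ n ih =>
      intro x
      rw [hsucc, List.mem_append, ih, Finset.mem_toList, Finset.mem_sdiff]
      have := @hA n (n + 1) (Nat.le_succ n) x
      tauto
  have hnodup : ∀ n, (l n).Nodup := by
    intro n
    induction n with
    | zero => exact Finset.nodup_toList _
    | succ n ih =>
      rw [hsucc]
      refine List.Nodup.append ih (Finset.nodup_toList _) fun x hx hx' => ?_
      exact (Finset.mem_sdiff.1 (Finset.mem_toList.1 hx')).2 ((hmem n x).1 hx)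
  have hset : ∀ n, (l n).toFinset = A n := fun n => by ext x; simp [hmem]
  have hlen : ∀ n, (l n).length = (A n).card := fun n => by
    rw [← hset, List.toFinset_card_of_nodup (hnodup n)]
  have hpre : ∀ n m, n ≤ m → l n <+: l m := by
    intro n m h
    induction m, h using Nat.le_induction with
    | base => exact List.prefix_rfl
    | succ m _ ih => exact ih.trans (hsucc m ▸ List.prefix_append _ _)
  choose N hN using fun i => (hcard.eventually_gt_atTop i).exists
  have hN' : ∀ i, i < (l (N i)).length := fun i => by rw [hlen]; exact hN i
  have he : ∀ i n, (h : i < (l n).length) → (l (N i))[i]'(hN' i) = (l n)[i] := by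
    intro i n h
    rcases le_total (N i) n with h' | h'
    · exact (hpre _ _ h').getElem (hN' i)
    · exact ((hpre _ _ h').getElem h).symm
  refine ⟨fun i => (l (N i))[i]'(hN' i), ?_, ?_⟩
  · intro i j hij
    obtain ⟨n, hn⟩ := (hcard.eventually_gt_atTop (max i j)).exists
    have hi : i < (l n).length := by rw [hlen]; omega
    have hj : j < (l n).length := by rw [hlen]; omega
    simp only [he i n hi, he j n hj] at hij
    exact (hnodup n).getElem_inj_iff.1 hij
  · intro n
    ext x
    rw [← hmem, List.mem_iff_getElem, Finset.mem_image]
    constructor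
    · rintro ⟨i, hi, rfl⟩
      exact ⟨i, by rw [Finset.mem_range, ← hlen]; exact hi, he i n hi⟩
    · rintro ⟨i, hi, rfl⟩
      rw [Finset.mem_range, ← hlen] at hi
      exact ⟨i, hi, (he i n hi).symm⟩

section

variable {Ω : Type*} [MeasurableSpace Ω] {μ : Measure Ω}

/-- The strong law of large numbers along an increasing sequence of finite index sets. -/
theorem ae_tendsto_sum_div_card {ι : Type*} {F : Measure ℝ} (hF : Integrable (fun x : ℝ => x) F)
    {X : ι → Ω → ℝ} (hX : ∀ i, HasLaw (X i) F μ) (hind : iIndepFun X μ)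
    {A : ℕ → Finset ι} (hA : Monotone A) (hcard : Tendsto (fun n => (A n).card) atTop atTop) :
    ∀ᵐ ω ∂μ, Tendsto (fun n => (∑ i ∈ A n, X i ω) / (A n).card) atTop (𝓝 (∫ x, x ∂F)) := by
  classical
  obtain ⟨e, hinj, he⟩ := Finset.exists_enumeration_of_monotone hA hcard
  have hint : Integrable (X (e 0)) μ := by
    have : Integrable (fun x : ℝ => x) (μ.map (X (e 0))) := by rwa [(hX (e 0)).map_eq]
    exact (integrable_map_measure (by fun_prop) (hX (e 0)).aemeasurable).1 this
  have h := strong_law_ae_real (fun i => X (e i)) hint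
    (fun i j hij => hind.indepFun (hinj.ne hij))
    (fun i => (hX (e i)).identDistrib (hX (e 0)))
  filter_upwards [h] with ω hω
  rw [(hX (e 0)).integral_eq] at hω
  refine (hω.comp hcard).congr fun n => ?_
  have : ∑ i ∈ A n, X i ω = ∑ i ∈ Finset.range (A n).card, X (e i) ω := by
    conv_lhs => rw [he n]
    exact Finset.sum_image fun i _ j _ h => hinj h
  simp [this]

open Classical in
/-- Hoeffding's inequality for the number of the conjunctions `⋂ e ∈ S w, E e` that occur, when the
conjunctions involve disjoint sets of independent events. -/
theorem measureReal_card_conj_le [IsProbabilityMeasure μ] {ι : Type*} {E : ι → Set Ω}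
    (hE : ∀ e, MeasurableSet (E e))
    (hind : iIndepSet E μ) {p : ℝ} (hp : ∀ e, μ.real (E e) = p) (s : Finset ℕ)
    {S : ℕ → Finset ι} (hS : (s : Set ℕ).PairwiseDisjoint S) {d : ℕ}
    (hd : ∀ w ∈ s, (S w).card = d) {η : ℝ} (hη : 0 ≤ η) :
    μ.real {ω | ((s.filter fun w => ∀ e ∈ S w, ω ∈ E e).card : ℝ) ≤ (p ^ d - η) * s.card} ≤
      Real.exp (-(2 * η ^ 2) * s.card) := by
  let D : s → Set Ω := fun w => ⋂ e ∈ S w, E e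
  have hDm : ∀ w, MeasurableSet (D w) := fun w =>
    Finset.measurableSet_biInter _ fun e _ => hE e
  have hDind : iIndepSet D μ := by
    rw [iIndepSet_iff_meas_biInter hDm]
    intro t
    have h1 : (⋂ w ∈ t, D w) = ⋂ e ∈ t.biUnion (fun w => S w), E e := by
      ext ω; simp [D]
    rw [h1, hind.meas_biInter, Finset.prod_biUnion]
    · exact Finset.prod_congr rfl fun w _ => (hind.meas_biInter _).symm
    · intro w _ w' _ hne
      exact hS w.2 w'.2 fun h => hne (Subtype.ext h)
  have hDp : ∀ w, μ.real (D w) = p ^ d := fun w => by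
    rw [measureReal_def, hind.meas_biInter, ENNReal.toReal_prod]
    rw [Finset.prod_congr rfl fun e _ => show (μ (E e)).toReal = p from hp e,
      Finset.prod_const, hd w w.2]
  let X : s → Ω → ℝ := fun w => -(D w).indicator fun _ => 1
  have hXm : ∀ w, Measurable (X w) := fun w => (measurable_const.indicator (hDm w)).neg
  have hXint : ∀ w, μ[X w] = -p ^ d := fun w => by
    simp only [X, Pi.neg_apply]
    rw [integral_neg, integral_indicator_const _ (hDm w), hDp]
    simp
  have hXind : iIndepFun (fun w ω => X w ω - μ[X w]) μ :=
    (hDind.iIndepFun_indicator (β := ℝ)).comp (fun w x => -x - ∫ ω, X w ω ∂μ) fun w => by fun_prop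
  have hsub : ∀ w ∈ (Finset.univ : Finset s),
      HasSubgaussianMGF (fun ω => X w ω - μ[X w]) ((‖(0 : ℝ) - (-1)‖₊ / 2) ^ 2) μ := by
    intro w _
    refine hasSubgaussianMGF_of_mem_Icc (hXm w).aemeasurable (Eventually.of_forall fun ω => ?_)
    simp only [X, Pi.neg_apply, Set.indicator]
    split_ifs <;> simp
  have hH := HasSubgaussianMGF.measure_sum_ge_le_of_iIndepFun hXind hsub
    (ε := η * s.card) (by positivity)
  refine le_trans (measureReal_mono fun ω hω => ?_) (hH.trans (Real.exp_le_exp.2 ?_))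
  · have hcount : ∑ w : s, (D w).indicator (fun _ => (1 : ℝ)) ω =
        ((s.filter fun w => ∀ e ∈ S w, ω ∈ E e).card : ℝ) := by
      rw [Finset.card_filter, Nat.cast_sum]
      refine Eq.trans ?_ (Finset.sum_coe_sort s _)
      refine Finset.sum_congr rfl fun w _ => ?_
      simp [D, Set.indicator]
    have hω' : ((s.filter fun w => ∀ e ∈ S w, ω ∈ E e).card : ℝ) ≤ (p ^ d - η) * s.card := hω
    show η * s.card ≤ ∑ w : s, (X w ω - μ[X w])
    rw [Finset.sum_sub_distrib, Finset.sum_congr rfl fun w _ => hXint w]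
    simp only [X, Pi.neg_apply, Finset.sum_neg_distrib, hcount, Finset.sum_const,
      Finset.card_univ, Fintype.card_coe, nsmul_eq_mul]
    linarith
  · rcases s.card.eq_zero_or_pos with h | h
    · simp [h]
    · have : (0 : ℝ) < s.card := by exact_mod_cast h
      simp
      apply le_of_eq
      field_simp

/-- Borel-Cantelli for linearly many exponentially unlikely events at each stage. -/
theorem ae_eventually_forall_lt_notMem [IsFiniteMeasure μ] {bad : ℕ → ℕ → Set Ω} {K c : ℝ}
    (hc : 0 < c)
    (h : ∀ n u, u < n → μ.real (bad n u) ≤ K * Real.exp (-c * n)) :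
    ∀ᵐ ω ∂μ, ∀ᶠ n in atTop, ∀ u < n, ω ∉ bad n u := by
  have hsum : Summable fun n : ℕ => K * ((n : ℝ) ^ 1 * Real.exp (-c * n)) :=
    (Real.summable_pow_mul_exp_neg_nat_mul 1 hc).mul_left K
  have hle : ∀ n, μ (⋃ u ∈ Finset.range n, bad n u) ≤
      ENNReal.ofReal (K * ((n : ℝ) ^ 1 * Real.exp (-c * n))) := by
    intro n
    rw [← ofReal_measureReal (measure_ne_top μ _)]
    refine ENNReal.ofReal_le_ofReal ((measureReal_biUnion_finset_le _ _).trans ?_)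
    refine (Finset.sum_le_sum fun u hu => h n u (Finset.mem_range.1 hu)).trans (le_of_eq ?_)
    simp
    ring
  have hne : ∑' n, μ (⋃ u ∈ Finset.range n, bad n u) ≠ ⊤ :=
    ne_top_of_le_ne_top hsum.tsum_ofReal_ne_top (ENNReal.tsum_le_tsum hle)
  filter_upwards [ae_eventually_notMem hne] with ω hω
  filter_upwards [hω] with n hn u hu hmem
  exact hn (Set.mem_biUnion (Finset.mem_coe.2 (Finset.mem_range.2 hu)) hmem)

end

/-! ### The upper bound -/

/-- The links `i < j` between the nodes `i, j < n` with `i < a`. -/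
def linksBelow (a n : ℕ) : Finset {e : ℕ × ℕ // e.1 < e.2} :=
  (Finset.range a ×ˢ Finset.range n).subtype fun e => e.1 < e.2

theorem linksBelow_mono {a b m n : ℕ} (hab : a ≤ b) (hmn : m ≤ n) :
    linksBelow a m ⊆ linksBelow b n := by
  intro e
  simp only [linksBelow, Finset.mem_subtype, Finset.mem_product, Finset.mem_range]
  omega

theorem sum_linksBelow (a n : ℕ) (f : ℕ → ℕ → ℝ) :
    ∑ e ∈ linksBelow a n, f e.1.1 e.1.2 =
      ∑ i ∈ Finset.range a, ∑ j ∈ Finset.range n, if i < j then f i j else 0 := by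
  rw [← Finset.sum_product', ← Finset.sum_filter]
  exact Finset.sum_subtype_eq_sum_filter (fun e : ℕ × ℕ => f e.1 e.2)

theorem sum_fin_links_eq {a n : ℕ} (ha : a ≤ n) (f : ℕ → ℕ → ℝ) :
    ∑ e : Fin n × Fin n with e.1 < e.2 ∧ (e.1 : ℕ) < a, f e.1 e.2 =
      ∑ e ∈ linksBelow a n, f e.1.1 e.1.2 := by
  refine Finset.sum_bij' (fun e he => ⟨(e.1, e.2), (Finset.mem_filter.1 he).2.1⟩)
    (fun e he => (⟨e.1.1, ?_⟩, ⟨e.1.2, ?_⟩)) ?_ ?_ ?_ ?_ ?_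
  · have := (Finset.mem_product.1 (Finset.mem_subtype.1 he)).1
    exact (Finset.mem_range.1 this).trans_le ha
  · have := (Finset.mem_product.1 (Finset.mem_subtype.1 he)).2
    exact Finset.mem_range.1 this
  · intro e he
    simp [linksBelow, (Finset.mem_filter.1 he).2.2]
  · intro e he
    have h1 := e.2
    have h2 := (Finset.mem_product.1 (Finset.mem_subtype.1 he)).1
    simpa using ⟨h1, by simpa using h2⟩
  · intro e he; rfl
  · intro e he; rfl
  · intro e he; rfl

theorem card_linksBelow {a n : ℕ} (ha : a ≤ n) :
    ((linksBelow a n).card : ℝ) = a * (2 * n - 1 - a) / 2 := by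
  have h := sum_linksBelow a n fun _ _ => 1
  simp only [Finset.sum_const, nsmul_eq_mul, mul_one] at h
  rw [h]
  have hrow : ∀ i < n, (∑ j ∈ Finset.range n, if i < j then (1 : ℝ) else 0) = n - 1 - i := by
    intro i hi
    have : (Finset.range n).filter (fun j => i < j) = Finset.Ioo i n := by
      ext j; simp; omega
    rw [← Finset.sum_filter, this]
    simp only [Finset.sum_const, nsmul_eq_mul, mul_one, Nat.card_Ioo]
    rw [Nat.cast_sub (by omega), Nat.cast_sub (by omega)]
    push_cast; ring
  rw [Finset.sum_congr rfl fun i hi => hrow i ((Finset.mem_range.1 hi).trans_le ha)]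
  clear h hrow ha
  induction a with
  | zero => simp
  | succ a ih => rw [Finset.sum_range_succ, ih]; push_cast; ring

theorem steinerPackingValue_mul_le {n k a : ℕ} (hk2 : 2 ≤ k) (hk : k ≤ n) (ha : a < k)
    {c : ℕ → ℕ → ℝ} (hc : ∀ i j, i < j → 0 ≤ c i j) :
    a * steinerPackingValue n k c ≤ ∑ e ∈ linksBelow a n, c e.1.1 e.1.2 := by
  obtain ⟨w, hw, hx⟩ := (isGreatest_steinerPackingValue hk2 hk hc).1
  rw [hx, ← sum_fin_links_eq (by omega)]
  exact hw.mul_sum_le ha hk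

theorem tendsto_floor_add_one_div {β : ℝ} (hβ : 0 ≤ β) :
    Tendsto (fun n : ℕ => ((⌊β * n⌋₊ + 1 : ℕ) : ℝ) / n) atTop (𝓝 β) := by
  have h1 := (tendsto_nat_floor_mul_div_atTop hβ).comp (tendsto_natCast_atTop_atTop (R := ℝ))
  have h2 := h1.add (tendsto_one_div_atTop_nhds_zero_nat (𝕜 := ℝ))
  rw [add_zero] at h2
  refine h2.congr fun n => ?_
  simp only [Function.comp]
  push_cast
  ring

section

variable {Ω : Type*} [MeasurableSpace Ω] {μ : Measure Ω}

/-- The almost sure upper bound given by the capacity of the links touching about `β * n` of the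
session nodes, where `β < α`. A single session node, the case `β = 0`, is always available, which
settles `α = 0`. -/
theorem ae_eventually_steinerPackingValue_div_lt {F : Measure ℝ}
    (hF : Integrable (fun x : ℝ => x) F)
    {X : {e : ℕ × ℕ // e.1 < e.2} → Ω → ℝ} (hX : ∀ e, HasLaw (X e) F μ) (hind : iIndepFun X μ)
    {C : ℕ → ℕ → Ω → ℝ} (hCX : ∀ e : {e : ℕ × ℕ // e.1 < e.2}, C e.1.1 e.1.2 = X e)
    (hC : ∀ᵐ ω ∂μ, ∀ i j, i < j → 0 ≤ C i j ω)
    {k : ℕ → ℕ} (hk : ∀ᶠ n in atTop, 2 ≤ k n ∧ k n ≤ n) {α : ℝ}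
    (hkα : Tendsto (fun n : ℕ => (k n : ℝ) / (n : ℝ)) atTop (𝓝 α))
    {β : ℝ} (hβ0 : 0 ≤ β) (hβ1 : β < 1) (hβ : β = 0 ∨ β < α) :
    ∀ᵐ ω ∂μ, ∀ x, (1 - β / 2) * ∫ x, x ∂F < x →
      ∀ᶠ n in atTop, steinerPackingValue n (k n) (fun i j => C i j ω) / (n : ℝ) < x := by
  set a : ℕ → ℕ := fun n => ⌊β * n⌋₊ + 1 with ha
  have ha_mono : Monotone a := fun m n h => by
    simp only [ha]
    gcongr
  have hlim : Tendsto (fun n => (a n : ℝ) / n) atTop (𝓝 β) := tendsto_floor_add_one_div hβ0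
  have han : ∀ᶠ n in atTop, a n ≤ n := by
    filter_upwards [hlim.eventually (eventually_lt_nhds hβ1), eventually_gt_atTop 0] with n h1 h2
    have : (0 : ℝ) < n := by exact_mod_cast h2
    rw [div_lt_one this] at h1
    exact_mod_cast h1.le
  have hak : ∀ᶠ n in atTop, a n < k n := by
    rcases hβ with rfl | h
    · filter_upwards [hk] with n hn
      simp [ha]; omega
    · obtain ⟨γ, h1, h2⟩ := exists_between h
      filter_upwards [hlim.eventually (eventually_lt_nhds h1),
        hkα.eventually (eventually_gt_nhds h2), eventually_gt_atTop 0] with n h3 h4 h5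
      have : (0 : ℝ) < n := by exact_mod_cast h5
      have := h3.trans h4
      rw [div_lt_div_iff_of_pos_right ‹_›] at this
      exact_mod_cast this
  have hratio : Tendsto (fun n => ((linksBelow (a n) n).card : ℝ) / (a n * n)) atTop
      (𝓝 (1 - β / 2)) := by
    have h := ((tendsto_const_nhds (x := (1 : ℝ))).sub
      ((tendsto_one_div_atTop_nhds_zero_nat (𝕜 := ℝ)).div_const 2)).sub (hlim.div_const 2)
    simp only [zero_div, sub_zero] at h
    refine h.congr' ?_
    filter_upwards [han, eventually_gt_atTop 0] with n h1 h2
    rw [card_linksBelow h1]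
    have h3 : (0 : ℝ) < n := by exact_mod_cast h2
    have h4 : (0 : ℝ) < a n := by exact_mod_cast Nat.succ_pos _
    field_simp
  have hcard : Tendsto (fun n => (linksBelow (a n) n).card) atTop atTop := by
    refine tendsto_atTop_mono (fun n => ?_) (tendsto_sub_atTop_nat 1)
    rcases Nat.eq_zero_or_pos n with rfl | hn
    · simp
    have h1 : (linksBelow 1 n).card ≤ (linksBelow (a n) n).card :=
      Finset.card_le_card (linksBelow_mono (by simp [ha]) le_rfl)
    have h2 := card_linksBelow (a := 1) hn
    have h3 : ((linksBelow 1 n).card : ℝ) = ((n - 1 : ℕ) : ℝ) := by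
      rw [h2, Nat.cast_sub hn]; push_cast; ring
    rw [← (by exact_mod_cast h3 : (linksBelow 1 n).card = n - 1)]
    exact h1
  have hslln := ae_tendsto_sum_div_card hF hX hind (A := fun n => linksBelow (a n) n)
    (fun m n h => linksBelow_mono (ha_mono h) h) hcard
  filter_upwards [hslln, hC] with ω hω hCω x hx
  have hprod := hratio.mul hω
  filter_upwards [hprod.eventually (eventually_lt_nhds hx), han, hak, hk, eventually_gt_atTop 0]
    with n h1 h2 h3 h4 h5
  refine lt_of_le_of_lt ?_ h1
  have hn : (0 : ℝ) < n := by exact_mod_cast h5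
  have han0 : (0 : ℝ) < a n := by exact_mod_cast Nat.succ_pos _
  have hle := steinerPackingValue_mul_le h4.1 h4.2 h3 hCω
  rw [Finset.sum_congr rfl fun e _ => congrFun (hCX e) ω] at hle
  have hcpos : (0 : ℝ) < (linksBelow (a n) n).card := by
    rw [card_linksBelow h2]
    have h6 : (a n : ℝ) ≤ n := by exact_mod_cast h2
    have h7 : (2 : ℝ) ≤ n := by exact_mod_cast h4.1.trans h4.2
    have : (0 : ℝ) < 2 * n - 1 - a n := by linarith
    positivity
  have heq : ((linksBelow (a n) n).card : ℝ) / (a n * n) *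
      ((∑ e ∈ linksBelow (a n) n, X e ω) / (linksBelow (a n) n).card) =
      (∑ e ∈ linksBelow (a n) n, X e ω) / (a n * n) := by
    field_simp
  rw [heq, div_le_div_iff₀ hn (by positivity)]
  nlinarith

end

/-! ### The lower bound for random graphs -/

/-- The link joining two different nodes; the value at `u = w` is arbitrary. -/
def link (u w : ℕ) : {e : ℕ × ℕ // e.1 < e.2} :=
  if h : u < w then ⟨(u, w), h⟩ else if h : w < u then ⟨(w, u), h⟩ else ⟨(0, 1), by norm_num⟩

theorem link_of_lt {u w : ℕ} (h : u < w) : link u w = ⟨(u, w), h⟩ := by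
  simp [link, h]

theorem link_comm (u w : ℕ) : link u w = link w u := by
  unfold link
  split_ifs <;> first | rfl | omega

theorem link_eq_iff {u w u' w' : ℕ} (h : u ≠ w) (h' : u' ≠ w') :
    link u w = link u' w' ↔ (u = u' ∧ w = w') ∨ (u = w' ∧ w = u') := by
  unfold link
  split_ifs <;> simp only [Subtype.mk.injEq, Prod.mk.injEq] <;> omega

/-- The graph on `n` nodes whose links are the links `e` with `ω ∈ E e`. -/
def eventGraph {Ω : Type*} (E : {e : ℕ × ℕ // e.1 < e.2} → Set Ω) (n : ℕ) (ω : Ω) :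
    SimpleGraph (Fin n) where
  Adj u v := u ≠ v ∧ ω ∈ E (link u v)
  symm := ⟨fun u v h => ⟨h.1.symm, link_comm u v ▸ h.2⟩⟩
  loopless := ⟨fun _ h => h.1 rfl⟩

theorem le_card_block {n B b : ℕ} (hb : b < B) :
    n / B ≤ ((Finset.range n).filter fun w => w / (n / B) = b).card := by
  rcases Nat.eq_zero_or_pos (n / B) with h | hL
  · omega
  · calc n / B = ((Finset.range (n / B)).image fun j => b * (n / B) + j).card := by
          rw [Finset.card_image_of_injective _ (add_right_injective _), Finset.card_range]
      _ ≤ _ := by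
          refine Finset.card_le_card fun w hw => ?_
          obtain ⟨j, hj, rfl⟩ := Finset.mem_image.1 hw
          rw [Finset.mem_range] at hj
          have h1 : (b + 1) * (n / B) ≤ n :=
            (Nat.mul_le_mul_right _ hb).trans (Nat.mul_div_le n B)
          rw [Finset.mem_filter, Finset.mem_range]
          refine ⟨by nlinarith, ?_⟩
          rw [mul_comm, Nat.mul_add_div hL, Nat.div_eq_of_lt hj, add_zero]

theorem sub_one_le_cast_div (n B : ℕ) : (n : ℝ) / B - 1 ≤ ((n / B : ℕ) : ℝ) := by
  rw [← Nat.floor_div_eq_div (K := ℝ)]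
  exact (Nat.sub_one_lt_floor _).le

theorem le_sum_blockRate {k L : ℕ} (hL : 0 < L) (B : ℕ) :
    (B : ℝ) - ((k : ℝ) / L + 1) / 2 ≤ ∑ b ∈ Finset.range B, blockRate k L b := by
  have h1 : ∀ b, blockRate k L b = 1 - (if b * L < k then 1 else 0) / 2 := fun b => by
    unfold blockRate; split_ifs <;> norm_num
  simp only [h1, Finset.sum_sub_distrib, ← Finset.sum_div, Finset.sum_boole, Finset.sum_const,
    Finset.card_range, nsmul_eq_mul, mul_one]
  have h2 : ((Finset.range B).filter fun b => b * L < k).card ≤ k / L + 1 := by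
    calc _ ≤ (Finset.range (k / L + 1)).card := by
          refine Finset.card_le_card fun b hb => ?_
          have := (Finset.mem_filter.1 hb).2
          rw [Finset.mem_range, Nat.lt_succ_iff, Nat.le_div_iff_mul_le hL]
          exact this.le
      _ = _ := Finset.card_range _
  have h3 : (((Finset.range B).filter fun b => b * L < k).card : ℝ) ≤ (k : ℝ) / L + 1 := by
    calc _ ≤ ((k / L + 1 : ℕ) : ℝ) := by exact_mod_cast h2
      _ ≤ _ := by push_cast; gcongr; exact Nat.cast_div_le
  linarith

section

variable {Ω : Type*} [MeasurableSpace Ω] {μ : Measure Ω} [IsProbabilityMeasure μ]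
  {E : {e : ℕ × ℕ // e.1 < e.2} → Set Ω} {p : ℝ}

open Classical in
/-- Every node of the random graph has almost the expected number of neighbours in every block not
containing it. -/
theorem ae_eventually_lt_card_block_neighbors (hE : ∀ e, MeasurableSet (E e))
    (hind : iIndepSet E μ) (hp : ∀ e, μ.real (E e) = p) {B b : ℕ} (hb : b < B) {η : ℝ}
    (hη : 0 < η) (hηp : η ≤ p) :
    ∀ᵐ ω ∂μ, ∀ᶠ n in atTop, ∀ u : Fin n, (u : ℕ) / (n / B) ≠ b →
      (p - η) * ((n / B : ℕ) : ℝ) <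
      (Finset.univ.filter fun v : Fin n =>
        (v : ℕ) / (n / B) = b ∧ (eventGraph E n ω).Adj u v).card := by
  let s : ℕ → Finset ℕ := fun n => (Finset.range n).filter fun w => w / (n / B) = b
  let bad : ℕ → ℕ → Set Ω := fun n u => {ω | u / (n / B) ≠ b ∧
    (((s n).filter fun w => ∀ e ∈ ({link u w} : Finset _), ω ∈ E e).card : ℝ) ≤
      (p ^ 1 - η) * (s n).card}
  have hB : (0 : ℝ) < B := by exact_mod_cast (Nat.zero_le b).trans_lt hb
  have hbad : ∀ n u, u < n →
      μ.real (bad n u) ≤ Real.exp (2 * η ^ 2) * Real.exp (-(2 * η ^ 2 / B) * n) := by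
    intro n u _
    by_cases hu : u / (n / B) = b
    · have : bad n u = ∅ := by ext ω; simp [bad, hu]
      rw [this, measureReal_empty]
      positivity
    · have hne : ∀ w ∈ s n, u ≠ w := by
        rintro w hw rfl
        exact hu (Finset.mem_filter.1 hw).2
      have h := measureReal_card_conj_le hE hind hp (s n) (S := fun w => {link u w}) (d := 1)
        (fun w hw w' hw' hww => by
          rw [Function.onFun, Finset.disjoint_singleton]
          intro h
          rw [link_eq_iff (hne w hw) (hne w' hw')] at h
          have := hne w' hw'
          tauto)
        (fun w _ => Finset.card_singleton _) hη.le
      refine (measureReal_mono fun ω hω => hω.2).trans (h.trans ?_)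
      rw [← Real.exp_add, Real.exp_le_exp]
      have h1 : (n : ℝ) / B - 1 ≤ (s n).card :=
        (sub_one_le_cast_div n B).trans (by exact_mod_cast le_card_block hb)
      have h2 : (2 * η ^ 2 / B) * n = 2 * η ^ 2 * (n / B) := by ring
      nlinarith [sq_nonneg η]
  filter_upwards [ae_eventually_forall_lt_notMem (by positivity) hbad] with ω hω
  filter_upwards [hω] with n hn u hu
  have h := hn u u.2
  simp only [bad, Set.mem_ofPred_eq, not_and, not_le, pow_one] at h
  have hcard : (n / B : ℕ) ≤ (s n).card := le_card_block hb
  calc (p - η) * ((n / B : ℕ) : ℝ) ≤ (p - η) * (s n).card := by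
        have : 0 ≤ p - η := by linarith
        gcongr
    _ < _ := h hu
    _ ≤ _ := by
        rw [Nat.cast_le, ← Finset.card_map Fin.valEmbedding]
        refine Finset.card_le_card fun w hw => ?_
        obtain ⟨hw, hwE⟩ := Finset.mem_filter.1 hw
        obtain ⟨hwn, hwb⟩ := Finset.mem_filter.1 hw
        refine Finset.mem_map.2 ⟨⟨w, Finset.mem_range.1 hwn⟩, ?_, rfl⟩
        rw [Finset.mem_filter]
        refine ⟨Finset.mem_univ _, hwb, ?_, hwE _ (Finset.mem_singleton_self _)⟩
        rintro rfl
        exact hu hwb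

open Classical in
/-- Consecutive nodes of the random graph have almost the expected number of common neighbours. -/
theorem ae_eventually_lt_card_common_neighbors (hE : ∀ e, MeasurableSet (E e))
    (hind : iIndepSet E μ) (hp : ∀ e, μ.real (E e) = p) {η : ℝ} (hη : 0 < η) (hηp : η ≤ p ^ 2) :
    ∀ᵐ ω ∂μ, ∀ᶠ n : ℕ in atTop, ∀ i, (h : i + 1 < n) →
      (p ^ 2 - η) * ((n : ℝ) - 2) <
      (Finset.univ.filter fun w : Fin n => (eventGraph E n ω).Adj ⟨i, by omega⟩ w ∧
        (eventGraph E n ω).Adj ⟨i + 1, h⟩ w).card := by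
  let s : ℕ → ℕ → Finset ℕ := fun n i => ((Finset.range n).erase i).erase (i + 1)
  have hs : ∀ n i : ℕ, (n : ℝ) - 2 ≤ (s n i).card := fun n i => by
    have h1 := Finset.pred_card_le_card_erase (s := Finset.range n) (a := i)
    have h2 := Finset.pred_card_le_card_erase (s := (Finset.range n).erase i) (a := i + 1)
    rw [Finset.card_range] at h1
    have h3 : n ≤ (s n i).card + 2 := by simp only [s]; omega
    have : (n : ℝ) ≤ (s n i).card + 2 := by exact_mod_cast h3
    linarith
  have hmem : ∀ n i w, w ∈ s n i ↔ w ≠ i + 1 ∧ w ≠ i ∧ w < n := fun n i w => by simp [s]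
  let S : ℕ → ℕ → Finset {e : ℕ × ℕ // e.1 < e.2} := fun i w => {link i w, link (i + 1) w}
  let bad : ℕ → ℕ → Set Ω := fun n i => {ω |
    (((s n i).filter fun w => ∀ e ∈ S i w, ω ∈ E e).card : ℝ) ≤
      (p ^ 2 - η) * (s n i).card}
  have hbad : ∀ n u, u < n →
      μ.real (bad n u) ≤ Real.exp (4 * η ^ 2) * Real.exp (-(2 * η ^ 2) * n) := by
    intro n i _
    have h := measureReal_card_conj_le hE hind hp (s n i)
      (S := S i) (d := 2)
      (fun w hw w' hw' hww => by
        obtain ⟨h1, h2, -⟩ := (hmem n i w).1 hw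
        obtain ⟨h1', h2', -⟩ := (hmem n i w').1 hw'
        rw [Function.onFun, Finset.disjoint_left]
        simp only [S, Finset.mem_insert, Finset.mem_singleton]
        rintro e (rfl | rfl) <;>
        rw [link_eq_iff (by omega) (by omega), link_eq_iff (by omega) (by omega)] <;> omega)
      (fun w hw => by
        obtain ⟨h1, h2, -⟩ := (hmem n i w).1 hw
        refine Finset.card_pair fun h => ?_
        rw [link_eq_iff (by omega) (by omega)] at h
        omega) hη.le
    refine h.trans ?_
    rw [← Real.exp_add, Real.exp_le_exp]
    nlinarith [sq_nonneg η, hs n i]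
  filter_upwards [ae_eventually_forall_lt_notMem (by positivity) hbad] with ω hω
  filter_upwards [hω] with n hn i hi
  have h := hn i (by omega)
  simp only [bad, Set.mem_ofPred_eq, not_le] at h
  calc (p ^ 2 - η) * ((n : ℝ) - 2) ≤ (p ^ 2 - η) * (s n i).card := by
        have : 0 ≤ p ^ 2 - η := by linarith
        have := hs n i
        gcongr
    _ < _ := h
    _ ≤ _ := by
        rw [Nat.cast_le, ← Finset.card_map Fin.valEmbedding]
        refine Finset.card_le_card fun w hw => ?_
        obtain ⟨hw, hwE⟩ := Finset.mem_filter.1 hw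
        obtain ⟨h1, h2, h3⟩ := (hmem n i w).1 hw
        refine Finset.mem_map.2 ⟨⟨w, h3⟩, ?_, rfl⟩
        rw [Finset.mem_filter]
        refine ⟨Finset.mem_univ _, ⟨?_, hwE _ (by simp [S])⟩, ⟨?_, hwE _ (by simp [S])⟩⟩
        · intro h; exact h2 (Fin.ext_iff.1 h).symm
        · intro h; exact h1 (Fin.ext_iff.1 h).symm

open Classical in
/-- The lower bound for unit capacities on the links of a random graph with link probability `p`:
use `block_rate_mem_steinerPackingValues` with a large but fixed number `B` of blocks. -/
theorem ae_eventually_exists_le_steinerPackingValues (hE : ∀ e, MeasurableSet (E e))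
    (hind : iIndepSet E μ) (hp : ∀ e, μ.real (E e) = p)
    {k : ℕ → ℕ} {α : ℝ} (hkα : Tendsto (fun n : ℕ => (k n : ℝ) / (n : ℝ)) atTop (𝓝 α))
    {x : ℝ} (hx : x < (1 - α / 2) * p) :
    ∀ᵐ ω ∂μ, ∀ᶠ n in atTop,
      ∃ y ∈ steinerPackingValues n (k n) (fun i j => if ω ∈ E (link i j) then 1 else 0),
        x * n ≤ y := by
  have hp0 : 0 ≤ p := hp (link 0 1) ▸ measureReal_nonneg
  have hp1 : p ≤ 1 := hp (link 0 1) ▸ measureReal_le_one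
  rcases hp0.eq_or_lt with rfl | hp0
  · refine Eventually.of_forall fun ω => Eventually.of_forall fun n => ⟨0, ?_, ?_⟩
    · refine ⟨fun _ => 0, ⟨fun _ _ => le_rfl, fun u v _ => ?_⟩, by simp⟩
      simp only [Finset.sum_const_zero]
      split_ifs <;> norm_num
    · rw [mul_zero] at hx
      exact mul_nonpos_of_nonpos_of_nonneg hx.le (Nat.cast_nonneg n)
  -- With `B` blocks, `T ≈ τ B * n` and `Q ≈ κ * n`, the rates divided by `n` tend to `y B`. The
  -- degrees into a block allow `T` up to `(p - 1 / B) * (n / B)`; the second `1 / B` taken off in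
  -- `τ` makes up for rounding the block length `n / B` down. Consecutive nodes have about
  -- `p ^ 2 * n` common neighbours, half of which are used.
  let κ : ℝ := p ^ 2 / 2
  have hκ : 0 < κ := by positivity
  let τ : ℕ → ℝ := fun B => (p - 2 / B) / B
  let y : ℕ → ℝ := fun B => τ B * (B - (α / (1 / B) + 1) / 2) / (1 + 4 * (τ B / κ))
  have hinv : Tendsto (fun B : ℕ => (1 : ℝ) / B) atTop (𝓝 0) :=
    tendsto_one_div_atTop_nhds_zero_nat
  have hy : Tendsto y atTop (𝓝 ((1 - α / 2) * p)) := by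
    have h1 : Tendsto (fun B : ℕ => (p - 2 * (1 / (B : ℝ))) * (1 - (α + 1 / B) / 2) /
        (1 + 4 * ((p - 2 * (1 / (B : ℝ))) * (1 / B) / κ))) atTop
        (𝓝 ((p - 2 * 0) * (1 - (α + 0) / 2) / (1 + 4 * ((p - 2 * 0) * 0 / κ)))) := by
      have h2 := (tendsto_const_nhds (x := p)).sub (hinv.const_mul 2)
      refine (h2.mul (tendsto_const_nhds.sub ((tendsto_const_nhds.add hinv).div_const 2))).div
        (tendsto_const_nhds.add (((h2.mul hinv).div_const κ).const_mul 4)) (by simp)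
    have h3 : (p - 2 * 0) * (1 - (α + 0) / 2) / (1 + 4 * ((p - 2 * 0) * 0 / κ)) =
        (1 - α / 2) * p := by simp; ring
    rw [h3] at h1
    refine h1.congr' ?_
    filter_upwards [eventually_gt_atTop 0] with B hB
    have : (B : ℝ) ≠ 0 := by positivity
    simp only [y, τ]
    congr 1
    · field_simp
    · ring
  obtain ⟨B, hBx, hBp, hB0⟩ := ((hy.eventually (eventually_gt_nhds hx)).and
    ((hinv.eventually (eventually_lt_nhds (show (0 : ℝ) < p / 2 by positivity))).and
      (eventually_gt_atTop 0))).exists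
  have hB : (0 : ℝ) < B := by exact_mod_cast hB0
  have hτ : 0 < τ B := by
    have : 2 / (B : ℝ) = 2 * (1 / B) := by ring
    have : 0 < p - 2 / B := by rw [this]; linarith
    positivity
  let T : ℕ → ℕ := fun n => ⌊τ B * n⌋₊
  let Q : ℕ → ℕ := fun n => ⌊κ * n⌋₊
  have hT : Tendsto (fun n => (T n : ℝ) / n) atTop (𝓝 (τ B)) :=
    (tendsto_nat_floor_mul_div_atTop hτ.le).comp (tendsto_natCast_atTop_atTop (R := ℝ))
  have hQ : Tendsto (fun n => (Q n : ℝ) / n) atTop (𝓝 κ) :=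
    (tendsto_nat_floor_mul_div_atTop hκ.le).comp (tendsto_natCast_atTop_atTop (R := ℝ))
  have hL : Tendsto (fun n => ((n / B : ℕ) : ℝ) / n) atTop (𝓝 (1 / B)) := by
    have h := (tendsto_nat_floor_mul_div_atTop (R := ℝ) (a := 1 / B) (by positivity)).comp
      (tendsto_natCast_atTop_atTop (R := ℝ))
    refine h.congr fun n => ?_
    simp only [Function.comp]
    rw [one_div_mul_eq_div, Nat.floor_div_eq_div]
  have hlim : Tendsto (fun n => ((T n : ℝ) / n) *
      (B - (((k n : ℝ) / n) / (((n / B : ℕ) : ℝ) / n) + 1) / 2) /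
      (1 + 4 * (((T n : ℝ) / n) / ((Q n : ℝ) / n)))) atTop (𝓝 (y B)) := by
    refine (hT.mul (tendsto_const_nhds.sub
      (((hkα.div hL (by positivity)).add tendsto_const_nhds).div_const 2))).div
      (tendsto_const_nhds.add ((hT.div hQ hκ.ne').const_mul 4)) ?_
    positivity
  have hblock : ∀ᵐ ω ∂μ, ∀ b < B, ∀ᶠ n in atTop, ∀ u : Fin n, (u : ℕ) / (n / B) ≠ b →
      (p - 1 / B) * ((n / B : ℕ) : ℝ) <
      (Finset.univ.filter fun v : Fin n =>
        (v : ℕ) / (n / B) = b ∧ (eventGraph E n ω).Adj u v).card := by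
    rw [ae_all_iff]
    intro b
    by_cases hb : b < B
    · filter_upwards [ae_eventually_lt_card_block_neighbors hE hind hp hb (η := 1 / B)
        (by positivity) (by linarith)] with ω hω _ using hω
    · exact Eventually.of_forall fun ω h => absurd h hb
  filter_upwards [hblock, ae_eventually_lt_card_common_neighbors hE hind hp (η := p ^ 2 / 4)
    (by positivity) (by nlinarith)] with ω hω1 hω2
  have hω1' : ∀ᶠ n in atTop, ∀ b ∈ Finset.range B, ∀ u : Fin n, (u : ℕ) / (n / B) ≠ b →
      (p - 1 / B) * ((n / B : ℕ) : ℝ) <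
      (Finset.univ.filter fun v : Fin n =>
        (v : ℕ) / (n / B) = b ∧ (eventGraph E n ω).Adj u v).card :=
    (Filter.eventually_all_finset _).2 fun b hb => hω1 b (Finset.mem_range.1 hb)
  filter_upwards [hω1', hω2, hlim.eventually (eventually_gt_nhds hBx),
    hQ.eventually (eventually_gt_nhds hκ), eventually_ge_atTop 6, eventually_ge_atTop (B ^ 2)]
    with n h1 h2 h3 h4 h5 h6
  have hn : (0 : ℝ) < n := by exact_mod_cast (by omega : 0 < n)
  have hL0 : 0 < n / B := Nat.div_pos (le_trans (by nlinarith) h6) hB0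
  have hQ0 : 0 < Q n := by
    rcases Nat.eq_zero_or_pos (Q n) with h | h
    · simp [h] at h4
    · exact h
  have hmem := block_rate_mem_steinerPackingValues (k := k n) (T := T n) (eventGraph E n ω) hL0
    (Nat.mul_div_le n B) hQ0 (c := fun i j => if ω ∈ E (link i j) then 1 else 0)
    (fun u v huv => by
      by_cases h : ω ∈ E (link u v)
      · simp only [h, if_true]; split_ifs <;> norm_num
      · simp [eventGraph, h])
    (fun b hb u hu => by
      have h := h1 b (Finset.mem_range.2 hb) u hu
      have hTn : (T n : ℝ) ≤ τ B * n := Nat.floor_le (by positivity)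
      have hLn := sub_one_le_cast_div n B
      have hn2 : (B : ℝ) ^ 2 ≤ n := by exact_mod_cast h6
      have e1 : τ B * n = (p - 2 / B) * (n / B) := by simp only [τ]; ring
      have e2 : 1 ≤ 1 / (B : ℝ) * (n / B) := by
        rw [← sub_nonneg]
        have : 1 / (B : ℝ) * (n / B) - 1 = (n - B ^ 2) / B ^ 2 := by field_simp
        rw [this]
        exact div_nonneg (by linarith) (by positivity)
      have e3 : (p - 1 / B) * ((n : ℝ) / B - 1) ≤ (p - 1 / B) * ((n / B : ℕ) : ℝ) :=
        mul_le_mul_of_nonneg_left hLn (by linarith)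
      have e4 : (p - 2 / B) * ((n : ℝ) / B) =
        (p - 1 / B) * ((n : ℝ) / B) - 1 / (B : ℝ) * (n / B) := by ring
      have e5 : 0 < 1 / (B : ℝ) := by positivity
      have : (T n : ℝ) ≤ _ := (show (T n : ℝ) ≤ (p - 1 / B) * ((n / B : ℕ) : ℝ) by
        nlinarith).trans h.le
      exact_mod_cast this)
    (fun i hi => by
      have h := h2 i hi
      have hQn : (Q n : ℝ) ≤ κ * n := Nat.floor_le (by positivity)
      have hn6 : (6 : ℝ) ≤ n := by exact_mod_cast h5
      have : (Q n : ℝ) ≤ _ := (show (Q n : ℝ) ≤ (p ^ 2 - p ^ 2 / 4) * ((n : ℝ) - 2) by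
        simp only [κ] at hQn
        nlinarith [sq_nonneg p]).trans h.le
      exact_mod_cast this)
  refine ⟨_, hmem, ?_⟩
  have hrate := le_sum_blockRate (k := k n) hL0 B
  have hLr : (0 : ℝ) < ((n / B : ℕ) : ℝ) := by exact_mod_cast hL0
  have hQr : (0 : ℝ) < Q n := by exact_mod_cast hQ0
  have e1 : ((k n : ℝ) / n) / (((n / B : ℕ) : ℝ) / n) = (k n : ℝ) / ((n / B : ℕ) : ℝ) := by
    field_simp
  have e2 : ((T n : ℝ) / n) / ((Q n : ℝ) / n) = (T n : ℝ) / Q n := by field_simp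
  rw [e1, e2] at h3
  calc x * n ≤ ((T n : ℝ) / n) * (B - ((k n : ℝ) / ((n / B : ℕ) : ℝ) + 1) / 2) /
        (1 + 4 * ((T n : ℝ) / Q n)) * n := by gcongr
    _ = (T n : ℝ) * (B - ((k n : ℝ) / ((n / B : ℕ) : ℝ) + 1) / 2) /
        (1 + 4 * ((T n : ℝ) / Q n)) := by field_simp
    _ ≤ _ := by gcongr

end

/-! ### The lower bound for general capacities -/

/-- The number of the thresholds `1 / N, 2 / N, …, N` not exceeding `x`, divided by `N`: the
decomposition of a capacity into unit layers. -/
noncomputable def layerSum (N : ℕ) (x : ℝ) : ℝ :=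
  1 / N * ∑ m ∈ Finset.range (N ^ 2), Set.indicator (Set.Ici (((m : ℝ) + 1) / N)) 1 x

theorem layerSum_eq {N : ℕ} (hN : 0 < N) {x : ℝ} (hx : 0 ≤ x) :
    layerSum N x = (min (N ^ 2) ⌊x * N⌋₊ : ℕ) / (N : ℝ) := by
  have hN' : (0 : ℝ) < N := by exact_mod_cast hN
  have h : ∀ m : ℕ, Set.indicator (Set.Ici (((m : ℝ) + 1) / N)) (1 : ℝ → ℝ) x =
      if m < ⌊x * N⌋₊ then 1 else 0 := by
    intro m
    simp only [Set.indicator, Set.mem_Ici, Pi.one_apply]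
    congr 1
    rw [div_le_iff₀ hN', eq_iff_iff, ← Nat.succ_le_iff, Nat.le_floor_iff (by positivity)]
    push_cast
    rfl
  unfold layerSum
  simp only [h]
  rw [Finset.sum_boole]
  have : (Finset.range (N ^ 2)).filter (fun m => m < ⌊x * N⌋₊) =
      Finset.range (min (N ^ 2) ⌊x * N⌋₊) := by
    ext m; simp
  rw [this, Finset.card_range]
  ring

theorem layerSum_le {N : ℕ} (hN : 0 < N) {x : ℝ} (hx : 0 ≤ x) : layerSum N x ≤ x := by
  have hN' : (0 : ℝ) < N := by exact_mod_cast hN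
  rw [layerSum_eq hN hx, div_le_iff₀ hN']
  calc ((min (N ^ 2) ⌊x * N⌋₊ : ℕ) : ℝ) ≤ ⌊x * N⌋₊ := by exact_mod_cast min_le_right _ _
    _ ≤ x * N := Nat.floor_le (by positivity)

theorem layerSum_nonneg (N : ℕ) (x : ℝ) : 0 ≤ layerSum N x := by
  refine mul_nonneg (by positivity) (Finset.sum_nonneg fun m _ => ?_)
  exact Set.indicator_nonneg (fun _ _ => zero_le_one) _

theorem tendsto_layerSum {x : ℝ} (hx : 0 ≤ x) :
    Tendsto (fun N => layerSum N x) atTop (𝓝 x) := by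
  have h := (tendsto_nat_floor_mul_div_atTop hx).comp (tendsto_natCast_atTop_atTop (R := ℝ))
  refine h.congr' ?_
  filter_upwards [eventually_gt_atTop 0, eventually_ge_atTop ⌈x⌉₊] with N hN hNx
  rw [layerSum_eq hN hx, min_eq_right]
  · rfl
  · have : x ≤ N := Nat.ceil_le.1 hNx
    have hN' : (0 : ℝ) ≤ N := Nat.cast_nonneg N
    refine Nat.floor_le_of_le ?_
    push_cast
    nlinarith

theorem integral_layerSum (N : ℕ) (F : Measure ℝ) [IsFiniteMeasure F] :
    ∫ x, layerSum N x ∂F =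
      1 / N * ∑ m ∈ Finset.range (N ^ 2), F.real (Set.Ici (((m : ℝ) + 1) / N)) := by
  unfold layerSum
  rw [integral_const_mul, integral_finsetSum]
  · congr 1
    exact Finset.sum_congr rfl fun m _ => integral_indicator_one measurableSet_Ici
  · intro m _
    exact (integrable_const (1 : ℝ)).indicator measurableSet_Ici

theorem tendsto_integral_layerSum {F : Measure ℝ} [IsFiniteMeasure F]
    (hF0 : ∀ᵐ x ∂F, 0 ≤ x) (hF : Integrable (fun x : ℝ => x) F) :
    Tendsto (fun N => ∫ x, layerSum N x ∂F) atTop (𝓝 (∫ x, x ∂F)) := by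
  rw [← tendsto_add_atTop_iff_nat 1]
  refine tendsto_integral_of_dominated_convergence (fun x => x) (fun N => ?_) hF (fun N => ?_) ?_
  · refine Measurable.aestronglyMeasurable ?_
    unfold layerSum
    exact (Finset.measurable_sum _ fun m _ =>
      measurable_one.indicator measurableSet_Ici).const_mul _
  · filter_upwards [hF0] with x hx
    rw [Real.norm_of_nonneg (layerSum_nonneg _ _)]
    exact layerSum_le N.succ_pos hx
  · filter_upwards [hF0] with x hx
    exact (tendsto_layerSum hx).comp (tendsto_add_atTop_nat 1)

section

variable {Ω : Type*} [MeasurableSpace Ω] {μ : Measure Ω} [IsProbabilityMeasure μ]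

/-- The almost sure lower bound: the layers of the capacities are random graphs, to which
`ae_eventually_exists_le_steinerPackingValues` applies, and their rates add up. -/
theorem ae_eventually_lt_steinerPackingValue_div {F : Measure ℝ} [IsProbabilityMeasure F]
    (hF0 : ∀ᵐ x ∂F, 0 ≤ x) (hF : Integrable (fun x : ℝ => x) F)
    {X : {e : ℕ × ℕ // e.1 < e.2} → Ω → ℝ} (hXm : ∀ e, Measurable (X e))
    (hX : ∀ e, HasLaw (X e) F μ) (hind : iIndepFun X μ)
    {C : ℕ → ℕ → Ω → ℝ}
    (hCX : ∀ᵐ ω ∂μ, ∀ e : {e : ℕ × ℕ // e.1 < e.2}, C e.1.1 e.1.2 ω = X e ω)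
    (hC : ∀ᵐ ω ∂μ, ∀ i j, i < j → 0 ≤ C i j ω)
    {k : ℕ → ℕ} (hk : ∀ᶠ n in atTop, 2 ≤ k n ∧ k n ≤ n) {α : ℝ}
    (hkα : Tendsto (fun n : ℕ => (k n : ℝ) / (n : ℝ)) atTop (𝓝 α)) :
    ∀ᵐ ω ∂μ, ∀ x, x < (1 - α / 2) * ∫ x, x ∂F →
      ∀ᶠ n in atTop, x < steinerPackingValue n (k n) (fun i j => C i j ω) / (n : ℝ) := by
  classical
  let p : ℕ → ℕ → ℝ := fun N m => F.real (Set.Ici (((m : ℝ) + 1) / N))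
  let E : ℕ → ℕ → {e : ℕ × ℕ // e.1 < e.2} → Set Ω := fun N m e =>
    X e ⁻¹' Set.Ici (((m : ℝ) + 1) / N)
  have hlayer : ∀ᵐ ω ∂μ, ∀ N m : ℕ, 0 < N → ∀ᶠ n in atTop,
      ∃ y ∈ steinerPackingValues n (k n) (fun i j => if ω ∈ E N m (link i j) then 1 else 0),
        ((1 - α / 2) * p N m - 1 / (N : ℝ) ^ 2) * n ≤ y := by
    rw [ae_all_iff]; intro N
    rw [ae_all_iff]; intro m
    rcases Nat.eq_zero_or_pos N with rfl | hN
    · exact Eventually.of_forall fun ω h => absurd h (lt_irrefl 0)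
    have hN' : (0 : ℝ) < N := by exact_mod_cast hN
    have hEind : iIndepSet (E N m) μ := by
      rw [iIndepSet_iff_meas_biInter fun e => hXm e measurableSet_Ici]
      intro s
      exact iIndepFun_iff_measure_inter_preimage_eq_mul.1 hind s fun e _ => measurableSet_Ici
    have hx : (1 - α / 2) * p N m - 1 / (N : ℝ) ^ 2 < (1 - α / 2) * p N m := by
      have : 0 < 1 / (N : ℝ) ^ 2 := by positivity
      linarith
    filter_upwards [ae_eventually_exists_le_steinerPackingValues
      (fun e => hXm e measurableSet_Ici) hEind
      (fun e => (hX e).measureReal_eq measurableSet_Ici) hkα hx] with ω hω _ using hω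
  filter_upwards [hlayer, hCX, hC] with ω hω hCXω hCω x hx
  have hg : Tendsto (fun N : ℕ => (1 - α / 2) * (∫ x, layerSum N x ∂F) - 1 / (N : ℝ)) atTop
      (𝓝 ((1 - α / 2) * ∫ x, x ∂F)) := by
    simpa using ((tendsto_integral_layerSum hF0 hF).const_mul (1 - α / 2)).sub
      (tendsto_one_div_atTop_nhds_zero_nat (𝕜 := ℝ))
  obtain ⟨N, hNx, hN⟩ :=
    ((hg.eventually (eventually_gt_nhds hx)).and (eventually_gt_atTop 0)).exists
  have hN' : (0 : ℝ) < N := by exact_mod_cast hN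
  have hall := (Filter.eventually_all_finset (Finset.range (N ^ 2))).2 fun m _ => hω N m hN
  filter_upwards [hall, hk, eventually_gt_atTop 0] with n hn hkn hn0
  have hn' : (0 : ℝ) < n := by exact_mod_cast hn0
  choose! y hy hle using hn
  have hmem := sum_mul_mem_steinerPackingValues (c := fun i j => C i j ω)
    (Finset.range (N ^ 2)) (a := 1 / (N : ℝ)) (by positivity) hy (fun i j hij => by
      refine le_trans (le_of_eq ?_) (layerSum_le hN (hCω i j hij))
      unfold layerSum
      congr 1
      refine Finset.sum_congr rfl fun m _ => ?_
      rw [link_of_lt hij, hCXω ⟨(i, j), hij⟩]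
      simp [E, Set.indicator])
  have hval := (isGreatest_steinerPackingValue hkn.1 hkn.2 hCω).2 hmem
  rw [lt_div_iff₀ hn']
  refine lt_of_lt_of_le ?_ hval
  calc x * n < ((1 - α / 2) * (∫ x, layerSum N x ∂F) - 1 / (N : ℝ)) * n := by gcongr
    _ = 1 / (N : ℝ) * ∑ m ∈ Finset.range (N ^ 2),
          ((1 - α / 2) * p N m - 1 / (N : ℝ) ^ 2) * n := by
        rw [integral_layerSum, ← Finset.sum_mul, Finset.sum_sub_distrib, ← Finset.mul_sum]
        simp only [Finset.sum_const, Finset.card_range, nsmul_eq_mul, p]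
        push_cast
        field_simp
    _ ≤ _ := by
        gcongr with m hm
        exact hle m hm

end

/-! ### The limit of the value -/

theorem mainTheorem1 {Ω : Type*} [MeasurableSpace Ω] (μ : Measure Ω) [IsProbabilityMeasure μ]
    (F : Measure ℝ) [IsProbabilityMeasure F]
    (hF_nonneg : ∀ᵐ x ∂F, 0 ≤ x) (hF_mean : Integrable (fun x : ℝ => x) F)
    (C : ℕ → ℕ → Ω → ℝ)
    (hC_law : ∀ i j : ℕ, i < j → HasLaw (C i j) F μ)
    (hC_indep : iIndepFun (fun e : {e : ℕ × ℕ // e.1 < e.2} => C e.1.1 e.1.2) μ)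
    (k : ℕ → ℕ) (hk : ∀ᶠ n in atTop, 2 ≤ k n ∧ k n ≤ n)
    (α : ℝ) (hα : α ∈ Set.Icc (0 : ℝ) 1)
    (hkα : Tendsto (fun n : ℕ => (k n : ℝ) / (n : ℝ)) atTop (𝓝 α)) :
    ∀ᵐ ω ∂μ,
      (∀ n : ℕ, 2 ≤ k n → k n ≤ n →
        IsGreatest (steinerPackingValues n (k n) (fun i j => C i j ω))
          (steinerPackingValue n (k n) (fun i j => C i j ω))) ∧
      Tendsto (fun n : ℕ => steinerPackingValue n (k n) (fun i j => C i j ω) / (n : ℝ)) atTop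
        (𝓝 ((1 - α / 2) * ∫ x, x ∂F)) := by
  have hC : ∀ᵐ ω ∂μ, ∀ i j, i < j → 0 ≤ C i j ω := by
    rw [ae_all_iff]; intro i
    rw [ae_all_iff]; intro j
    by_cases h : i < j
    · have hp : Measurable fun x : ℝ => 0 ≤ x :=
        measurableSet_setOfPred.1 measurableSet_Ici
      filter_upwards [((hC_law i j h).ae_iff hp).2 hF_nonneg] with ω hω _ using hω
    · exact Eventually.of_forall fun ω h' => absurd h' h
  -- Measurable versions of the capacities, so that the layers are measurable events.
  let X : {e : ℕ × ℕ // e.1 < e.2} → Ω → ℝ := fun e => (hC_law _ _ e.2).aemeasurable.mk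
  have hXC : ∀ e : {e : ℕ × ℕ // e.1 < e.2}, C e.1.1 e.1.2 =ᵐ[μ] X e := fun e =>
    (hC_law _ _ e.2).aemeasurable.ae_eq_mk
  have hCX : ∀ᵐ ω ∂μ, ∀ e : {e : ℕ × ℕ // e.1 < e.2}, C e.1.1 e.1.2 ω = X e ω :=
    ae_all_iff.2 hXC
  have hlower := ae_eventually_lt_steinerPackingValue_div hF_nonneg hF_mean
    (fun e => (hC_law _ _ e.2).aemeasurable.measurable_mk)
    (fun e => (hC_law _ _ e.2).congr (hXC e).symm) (hC_indep.congr hXC) hCX hC hk hkα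
  -- Proportions tending to `α`, each of them below `α` or equal to `0`.
  let β : ℕ → ℝ := fun m => max 0 (α - 1 / ((m : ℝ) + 1))
  have hβpos : ∀ m : ℕ, 0 < 1 / ((m : ℝ) + 1) := fun m => by positivity
  have hβ : Tendsto β atTop (𝓝 α) := by
    have h := (tendsto_const_nhds (x := (0 : ℝ))).max
      ((tendsto_const_nhds (x := α)).sub (tendsto_one_div_add_atTop_nhds_zero_nat (𝕜 := ℝ)))
    rwa [sub_zero, max_eq_right hα.1] at h
  have hupper : ∀ᵐ ω ∂μ, ∀ m, ∀ x, (1 - β m / 2) * ∫ x, x ∂F < x →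
      ∀ᶠ n in atTop, steinerPackingValue n (k n) (fun i j => C i j ω) / (n : ℝ) < x := by
    rw [ae_all_iff]
    intro m
    refine ae_eventually_steinerPackingValue_div_lt hF_mean (fun e => hC_law _ _ e.2) hC_indep
      (fun e => rfl) hC hk hkα (le_max_left _ _) ?_ ?_
    · exact max_lt one_pos (by linarith [hα.2, hβpos m])
    · rcases le_total (α - 1 / ((m : ℝ) + 1)) 0 with h | h
      · exact Or.inl (max_eq_left h)
      · right
        simp only [β, max_eq_right h]
        linarith [hβpos m]
  filter_upwards [hC, hlower, hupper] with ω hω hl hu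
  refine ⟨fun n h2 hn => isGreatest_steinerPackingValue h2 hn hω, ?_⟩
  rw [tendsto_order]
  refine ⟨fun x hx => hl x hx, fun x hx => ?_⟩
  have hlim : Tendsto (fun m => (1 - β m / 2) * ∫ x, x ∂F) atTop
      (𝓝 ((1 - α / 2) * ∫ x, x ∂F)) :=
    (tendsto_const_nhds.sub (hβ.div_const 2)).mul_const _
  obtain ⟨m, hm⟩ := (hlim.eventually (eventually_lt_nhds hx)).exists
  exact hu m x hm
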